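/- Let $\Sigma=\mathbb{F}_2$. For positive integers $s,k,m,t,r$, an $(s,k,m,t,r)$ locality functional array code is an encoding map $\mathcal{E}:\Sigma^s\to(\Sigma^t)^m$, which stores $s$ information bits $x=(x_1,\dots,x_s)$ in $m$ buckets (columns) of $t$ bits each, such that for every $v\in\Sigma^s$ there are $k$ pairwise disjoint sets of buckets $S_1,\dots,S_k\subseteq\{1,\dots,m\}$ with $|S_j|\le r$, each of which is a recovering set for the request $v$: the linear combination $\langle v,x\rangle=\sum_i v_ix_i$ is, for all $x\in\Sigma^s$, a function of the contents of the buckets in $S_j$ (all $t$ bits of each such bucket may be read). Let $D(s,k,t,r)$ be the smallest $m$ for which an $(s,k,m,t,r)$ locality functional array code exists. Theorem. $D(7,1,2,2)=7$. Moreover, the value $7$ is attained by a linear encoding map, so the minimum is $7$ also when only $\mathbb{F}_2$-linear encoding maps are allowed. -/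

import Mathlib

/-- An encoding map of `s` information bits into `m` buckets (columns) of `t` cells each:
`E x b c` is the bit stored in cell `c` of bucket `b` when the information vector is `x`.
The map is arbitrary, not necessarily linear. -/
abbrev ArrayEncoder (s m t : ℕ) : Type :=
  (Fin s → ZMod 2) → (Fin m → Fin t → ZMod 2)

/-- `S` is a recovering set for the request `v`: some decoding function computes the linear
combination `⟨v, x⟩ = ∑ i, v i * x i` of the information bits from the contents of the
buckets in `S` (all cells of these buckets may be read). -/
def IsRecoveringSet {s m t : ℕ} (E : ArrayEncoder s m t) (v : Fin s → ZMod 2)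
    (S : Finset (Fin m)) : Prop :=
  ∃ dec : (S → Fin t → ZMod 2) → ZMod 2,
    ∀ x : Fin s → ZMod 2, dec (fun b => E x b) = v ⬝ᵥ x

/-- `E` is an `(s, k, m, t, r)` locality functional array code: every linear combination of the
information bits has `k` mutually disjoint recovering sets, each of at most `r` buckets. -/
def IsLocalityFunctionalArrayCode (s k m t r : ℕ) (E : ArrayEncoder s m t) : Prop :=
  ∀ v : Fin s → ZMod 2, ∃ S : Fin k → Finset (Fin m),
    (∀ i j, i ≠ j → Disjoint (S i) (S j)) ∧
      ∀ j, (S j).card ≤ r ∧ IsRecoveringSet E v (S j)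

/-- `localityD s k t r` is `D(s, k, t, r)`, the smallest number `m` of buckets for which an
`(s, k, m, t, r)` locality functional array code exists (and `0` if there is none, so that a
positive value is always attained). -/
noncomputable def localityD (s k t r : ℕ) : ℕ :=
  sInf {m : ℕ | ∃ E : ArrayEncoder s m t, IsLocalityFunctionalArrayCode s k m t r E}

/-! Recovery is first freed from linearity of the encoder. The requests recovered by a set of
buckets form a subspace, and pigeonhole bounds its dimension by the number of cells, so a pair
recovers at most 16 of the 128 requests. If a pair is full, that is, attains dimension four, its
contents and the answers to its requests determine each other. Call a bucket linear if it recovers a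
two-dimensional space on its own: it acts as a line of the projective space, and two of them recover
exactly the span of their lines (`recoverable_pair_of_linear`). A nonlinear bucket `b` in a full
pair has a `bucketSpan` of dimension at least three (`lt_finrank_bucketSpan`). This space lies in
every full pair containing `b`, so these pairs overlap heavily.

With six buckets of which at most five are linear, overlaps alone suffice. `exists_count` adds up
the requests pair by pair, guided by a maximal matching of full pairs among the nonlinear buckets
with no full linear partner, and `count_lt` finds a total below 128.

Six linear buckets are a question about six lines in dimension seven
(`card_pairCover_lt_of_card_six`). The naive count is 1 + 18 + 135 = 154, so overlaps are needed
again. If two lines meet, at most 125 points are covered. If any three lines are independent, the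
spans of two disjoint pairs must meet for reasons of dimension, and double counting leaves at most
124. The hard case is three disjoint lines carrying points with sum zero (`not_cover_of_dependent`).
If everything were covered, the other three lines would be complements of a five-dimensional space
`W` containing the triple. At least four points of `W` are off the pair spans of the triple, but
each pair of the other lines supplies at most one of them.

Seven buckets suffice by an explicit list of seven lines, checked on all 128 requests. -/

open Module Submodule

/-! ### Duality between requests and information vectors, and counting of values. -/

/-- The vectors orthogonal to a space of requests, for the standard dot product. -/
def dotPerp {s : ℕ} (A : Submodule (ZMod 2) (Fin s → ZMod 2)) :
    Submodule (ZMod 2) (Fin s → ZMod 2) where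
  carrier := {x | ∀ v ∈ A, v ⬝ᵥ x = 0}
  add_mem' := by
    intro x y hx hy v hv
    rw [dotProduct_add, hx v hv, hy v hv, add_zero]
  zero_mem' := by
    intro v _
    exact dotProduct_zero v
  smul_mem' := by
    intro c x hx v hv
    rw [dotProduct_smul, hx v hv, smul_zero]

theorem dotPerp_eq_orthogonal {s : ℕ} (A : Submodule (ZMod 2) (Fin s → ZMod 2)) :
    dotPerp A = LinearMap.BilinForm.orthogonal
      (dotProductBilin (ZMod 2) (ZMod 2) : LinearMap.BilinForm (ZMod 2) (Fin s → ZMod 2)) A := by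
  ext x
  rfl

theorem dotProductBilin_isRefl (s : ℕ) :
    LinearMap.BilinForm.IsRefl
      (dotProductBilin (ZMod 2) (ZMod 2) : LinearMap.BilinForm (ZMod 2) (Fin s → ZMod 2)) := by
  intro x y h
  change y ⬝ᵥ x = 0
  rw [dotProduct_comm]
  exact h

theorem dotProductBilin_nondegenerate (s : ℕ) :
    LinearMap.BilinForm.Nondegenerate
      (dotProductBilin (ZMod 2) (ZMod 2) : LinearMap.BilinForm (ZMod 2) (Fin s → ZMod 2)) := by
  rw [LinearMap.BilinForm.Nondegenerate, LinearMap.IsRefl.nondegenerate_iff_separatingLeft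
    (dotProductBilin_isRefl s)]
  intro x h
  exact dotProduct_eq_zero x h

theorem dotPerp_dotPerp {s : ℕ} (A : Submodule (ZMod 2) (Fin s → ZMod 2)) :
    dotPerp (dotPerp A) = A := by
  rw [dotPerp_eq_orthogonal, dotPerp_eq_orthogonal]
  exact LinearMap.BilinForm.orthogonal_orthogonal (dotProductBilin_nondegenerate s)
    (dotProductBilin_isRefl s) A

theorem dotPerp_anti {s : ℕ} {A B : Submodule (ZMod 2) (Fin s → ZMod 2)} (h : A ≤ B) :
    dotPerp B ≤ dotPerp A := fun _ hx v hv => hx v (h hv)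

theorem dotPerp_inf {s : ℕ} (A B : Submodule (ZMod 2) (Fin s → ZMod 2)) :
    dotPerp (A ⊓ B) = dotPerp A ⊔ dotPerp B := by
  apply le_antisymm
  · rw [← dotPerp_dotPerp (dotPerp A ⊔ dotPerp B)]
    apply dotPerp_anti
    apply le_inf
    · conv_rhs => rw [← dotPerp_dotPerp A]
      exact dotPerp_anti le_sup_left
    · conv_rhs => rw [← dotPerp_dotPerp B]
      exact dotPerp_anti le_sup_right
  · exact sup_le (dotPerp_anti inf_le_left) (dotPerp_anti inf_le_right)

theorem card_quotient_dotPerp {s : ℕ} (A : Submodule (ZMod 2) (Fin s → ZMod 2)) :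
    Nat.card ((Fin s → ZMod 2) ⧸ dotPerp A) = 2 ^ finrank (ZMod 2) A := by
  rw [Module.natCard_eq_pow_finrank (K := ZMod 2), Nat.card_zmod]
  congr 1
  have h1 := Submodule.finrank_quotient_add_finrank (dotPerp A)
  have h2 := LinearMap.BilinForm.finrank_orthogonal (dotProductBilin_nondegenerate s) A
  rw [← dotPerp_eq_orthogonal] at h2
  have h3 := Submodule.finrank_le A
  omega

theorem out_sub_mem {s : ℕ} (P : Submodule (ZMod 2) (Fin s → ZMod 2)) (x : Fin s → ZMod 2) :
    (Quotient.out (Submodule.Quotient.mk x : (Fin s → ZMod 2) ⧸ P)) - x ∈ P := by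
  rw [← Submodule.Quotient.eq]
  exact Quotient.out_eq _

/-- `f` need not be constant on the classes modulo `dotPerp A`, so it is evaluated on chosen
representatives. -/
theorem injective_comp_out {s : ℕ} {X : Type*} (f : (Fin s → ZMod 2) → X)
    (A : Submodule (ZMod 2) (Fin s → ZMod 2)) (h : ∀ x y, f x = f y → x - y ∈ dotPerp A) :
    Function.Injective (fun p : (Fin s → ZMod 2) ⧸ dotPerp A => f (Quotient.out p)) := by
  intro p q hpq
  have := h _ _ hpq
  rw [← Submodule.Quotient.eq] at this
  rw [← Quotient.out_eq p, ← Quotient.out_eq q]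
  exact this

/-- A function that determines all requests in `A` takes at least `2 ^ dim A` values. -/
theorem two_pow_finrank_le_card {s : ℕ} {X : Type*} [Finite X] (f : (Fin s → ZMod 2) → X)
    (A : Submodule (ZMod 2) (Fin s → ZMod 2)) (h : ∀ x y, f x = f y → x - y ∈ dotPerp A) :
    2 ^ finrank (ZMod 2) A ≤ Nat.card X := by
  rw [← card_quotient_dotPerp]
  exact Nat.card_le_card_of_injective _ (injective_comp_out f A h)

theorem bijective_comp_out {s : ℕ} {X : Type*} [Finite X] (f : (Fin s → ZMod 2) → X)
    (A : Submodule (ZMod 2) (Fin s → ZMod 2)) (h : ∀ x y, f x = f y → x - y ∈ dotPerp A)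
    (hc : Nat.card X ≤ 2 ^ finrank (ZMod 2) A) :
    Function.Bijective (fun p : (Fin s → ZMod 2) ⧸ dotPerp A => f (Quotient.out p)) := by
  refine (Nat.bijective_iff_injective_and_card _).2 ⟨injective_comp_out f A h, ?_⟩
  rw [card_quotient_dotPerp]
  refine le_antisymm ?_ hc
  exact two_pow_finrank_le_card f A h

/-- A function that determines the requests in `A` and takes no more than `2 ^ dim A` values is
determined by the requests in `A`. -/
theorem eq_of_sub_mem_dotPerp {s : ℕ} {X : Type*} [Finite X] (f : (Fin s → ZMod 2) → X)
    (A : Submodule (ZMod 2) (Fin s → ZMod 2)) (h : ∀ x y, f x = f y → x - y ∈ dotPerp A)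
    (hc : Nat.card X ≤ 2 ^ finrank (ZMod 2) A) {x y : Fin s → ZMod 2}
    (hxy : x - y ∈ dotPerp A) : f x = f y := by
  -- By counting, some representative attains the value `f z`; equal values force equal classes, so
  -- it is the representative of the class of `z`.
  have key : ∀ z, f z = f (Quotient.out (Submodule.Quotient.mk z : _ ⧸ dotPerp A)) := by
    intro z
    obtain ⟨p, hp⟩ := (bijective_comp_out f A h hc).2 (f z)
    have hp' : f (Quotient.out p) = f z := hp
    have h1 := h _ _ hp'
    rw [← Submodule.Quotient.eq] at h1
    have h2 : p = Submodule.Quotient.mk z := by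
      rw [← h1]
      exact (Quotient.out_eq p).symm
    rw [← h2, hp']
  rw [key x, key y, (Submodule.Quotient.eq _).2 hxy]

theorem surjective_of_card_le {s : ℕ} {X : Type*} [Finite X] (f : (Fin s → ZMod 2) → X)
    (A : Submodule (ZMod 2) (Fin s → ZMod 2)) (h : ∀ x y, f x = f y → x - y ∈ dotPerp A)
    (hc : Nat.card X ≤ 2 ^ finrank (ZMod 2) A) : Function.Surjective f := by
  intro z
  obtain ⟨p, hp⟩ := (bijective_comp_out f A h hc).2 z
  exact ⟨_, hp⟩

/-! ### Recovery spaces, and the spaces on which single buckets depend. -/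

section Encoder

variable {s m t : ℕ} (E : ArrayEncoder s m t)

/-- The space of requests that the buckets in `S` recover. -/
def recoverable (S : Finset (Fin m)) : Submodule (ZMod 2) (Fin s → ZMod 2) where
  carrier := {v | ∀ x y, (∀ b ∈ S, E x b = E y b) → v ⬝ᵥ x = v ⬝ᵥ y}
  add_mem' := by
    intro v w hv hw x y h
    rw [add_dotProduct, add_dotProduct, hv x y h, hw x y h]
  zero_mem' := by
    intro x y _
    rw [zero_dotProduct, zero_dotProduct]
  smul_mem' := by
    intro c v hv x y h
    rw [smul_dotProduct, smul_dotProduct, hv x y h]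

variable {E}

theorem isRecoveringSet_iff {S : Finset (Fin m)} {v : Fin s → ZMod 2} :
    IsRecoveringSet E v S ↔ v ∈ recoverable E S := by
  constructor
  · rintro ⟨dec, h⟩ x y hxy
    rw [← h x, ← h y]
    congr 1
    funext b
    exact hxy b b.2
  · intro h
    classical
    -- Decode through any information vector with these contents; the value on contents that never
    -- occur is irrelevant.
    refine ⟨fun z => if hz : ∃ x, (fun b : S => E x b) = z then v ⬝ᵥ hz.choose else 0, ?_⟩
    intro x
    have hz : ∃ y, (fun b : S => E y b) = (fun b : S => E x b) := ⟨x, rfl⟩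
    simp only [dif_pos hz]
    apply h
    intro b hb
    exact congrFun hz.choose_spec ⟨b, hb⟩

theorem recoverable_mono {S T : Finset (Fin m)} (h : S ⊆ T) : recoverable E S ≤ recoverable E T :=
  fun _ hv x y hxy => hv x y fun b hb => hxy b (h hb)

variable (E) in
/-- The contents of the buckets in `S`. -/
def contents (S : Finset (Fin m)) (x : Fin s → ZMod 2) : S → Fin t → ZMod 2 := fun b => E x b

theorem contents_eq_iff {S : Finset (Fin m)} {x y : Fin s → ZMod 2} :
    contents E S x = contents E S y ↔ ∀ b ∈ S, E x b = E y b := by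
  constructor
  · intro h b hb
    exact congrFun h ⟨b, hb⟩
  · intro h
    funext b
    exact h b b.2

theorem card_contents (S : Finset (Fin m)) :
    Nat.card (S → Fin t → ZMod 2) = 2 ^ (t * S.card) := by
  simp [pow_mul]

theorem sub_mem_dotPerp_recoverable {S : Finset (Fin m)} (x y : Fin s → ZMod 2)
    (h : contents E S x = contents E S y) : x - y ∈ dotPerp (recoverable E S) := by
  intro v hv
  rw [dotProduct_sub, hv x y (contents_eq_iff.1 h), sub_self]

theorem finrank_recoverable_le (S : Finset (Fin m)) :
    finrank (ZMod 2) (recoverable E S) ≤ t * S.card := by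
  have := two_pow_finrank_le_card (contents E S) _ sub_mem_dotPerp_recoverable
  rw [card_contents] at this
  exact (Nat.pow_le_pow_iff_right (by norm_num)).1 this

variable (E) in
/-- The translations of the information vector that leave bucket `b` unchanged. -/
def bucketPeriods (b : Fin m) : Submodule (ZMod 2) (Fin s → ZMod 2) where
  carrier := {h | ∀ x, E (x + h) b = E x b}
  add_mem' := by
    intro h k hh hk x
    rw [← add_assoc, hk, hh]
  zero_mem' := by
    intro x
    rw [add_zero]
  smul_mem' := by
    intro c h hh x
    obtain rfl | rfl : c = 0 ∨ c = 1 := by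
      revert c
      decide
    · rw [zero_smul, add_zero]
    · rw [one_smul, hh]

variable (E) in
/-- The requests that together determine bucket `b`: the smallest space with this property. -/
def bucketSpan (b : Fin m) : Submodule (ZMod 2) (Fin s → ZMod 2) := dotPerp (bucketPeriods E b)

theorem eq_of_sub_mem_bucketSpan {b : Fin m} {x y : Fin s → ZMod 2}
    (h : x - y ∈ dotPerp (bucketSpan E b)) : E x b = E y b := by
  rw [bucketSpan, dotPerp_dotPerp] at h
  have := h y
  rwa [add_sub_cancel] at this

theorem bucketSpan_le {b : Fin m} {A : Submodule (ZMod 2) (Fin s → ZMod 2)}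
    (h : ∀ x y, x - y ∈ dotPerp A → E x b = E y b) : bucketSpan E b ≤ A := by
  rw [← dotPerp_dotPerp A]
  apply dotPerp_anti
  intro k hk x
  apply h
  rwa [add_sub_cancel_left]

theorem recoverable_le_bucketSpan (b : Fin m) : recoverable E {b} ≤ bucketSpan E b := by
  intro v hv h hh
  rw [dotProduct_comm]
  have := hv (0 + h) 0 (by simpa using hh 0)
  simpa using this

/-- A translation that changes neither bucket cannot change a recovered request. The common periods
are an intersection, whose orthogonal space is the sum of the two spans. -/
theorem recoverable_pair_le (b c : Fin m) :
    recoverable E {b, c} ≤ bucketSpan E b ⊔ bucketSpan E c := by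
  rw [bucketSpan, bucketSpan, ← dotPerp_inf]
  intro v hv h hh
  rw [dotProduct_comm]
  have := hv (0 + h) 0 (by
    intro d hd
    obtain rfl | rfl := by simpa using hd
    · exact hh.1 0
    · exact hh.2 0)
  simpa using this

/-- A bucket set that recovers as many requests as it has cells is determined by them. -/
theorem eq_of_finrank_eq {S : Finset (Fin m)}
    (hS : finrank (ZMod 2) (recoverable E S) = t * S.card) {x y : Fin s → ZMod 2}
    (h : x - y ∈ dotPerp (recoverable E S)) : ∀ b ∈ S, E x b = E y b := by
  rw [← contents_eq_iff]
  refine eq_of_sub_mem_dotPerp (contents E S) _ sub_mem_dotPerp_recoverable ?_ h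
  rw [card_contents, hS]

theorem surjective_contents {S : Finset (Fin m)}
    (hS : finrank (ZMod 2) (recoverable E S) = t * S.card) :
    Function.Surjective (contents E S) := by
  refine surjective_of_card_le (contents E S) _ sub_mem_dotPerp_recoverable ?_
  rw [card_contents, hS]

theorem bucketSpan_le_recoverable {S : Finset (Fin m)}
    (hS : finrank (ZMod 2) (recoverable E S) = t * S.card) {b : Fin m} (hb : b ∈ S) :
    bucketSpan E b ≤ recoverable E S :=
  bucketSpan_le fun _ _ h => eq_of_finrank_eq hS h b hb

theorem recoverable_pair_eq_sup {b c : Fin m} (hbc : b ≠ c)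
    (h : finrank (ZMod 2) (recoverable E {b, c}) = t * 2) :
    recoverable E {b, c} = bucketSpan E b ⊔ bucketSpan E c := by
  have hS : finrank (ZMod 2) (recoverable E {b, c}) = t * ({b, c} : Finset (Fin m)).card := by
    rw [Finset.card_pair hbc, h]
  apply le_antisymm (recoverable_pair_le b c)
  exact sup_le (bucketSpan_le_recoverable hS (by simp)) (bucketSpan_le_recoverable hS (by simp))

theorem bucketSpan_eq_recoverable {b : Fin m}
    (h : finrank (ZMod 2) (recoverable E {b}) = t) : bucketSpan E b = recoverable E {b} :=
  le_antisymm (bucketSpan_le_recoverable (by simpa using h) (by simp)) (recoverable_le_bucketSpan b)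

/-- This turns linear buckets into plain subspaces: combining two of them yields nothing beyond sums
of their own requests. -/
theorem recoverable_pair_of_linear {b c : Fin m}
    (hb : finrank (ZMod 2) (recoverable E {b}) = t)
    (hc : finrank (ZMod 2) (recoverable E {c}) = t) :
    recoverable E {b, c} = recoverable E {b} ⊔ recoverable E {c} := by
  apply le_antisymm
  · rw [← bucketSpan_eq_recoverable hb, ← bucketSpan_eq_recoverable hc]
    exact recoverable_pair_le b c
  · exact sup_le (recoverable_mono (by simp)) (recoverable_mono (by simp))

/-- A bucket whose contents take all values depends on at least `t` requests, and if it depends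
on exactly `t` of them it recovers them all. -/
theorem finrank_recoverable_of_surjective {b : Fin m} (hE : Function.Surjective fun x => E x b)
    (h : finrank (ZMod 2) (bucketSpan E b) ≤ t) : finrank (ZMod 2) (recoverable E {b}) = t := by
  have hcard : Nat.card (Fin t → ZMod 2) = 2 ^ t := by simp
  let g : (Fin s → ZMod 2) ⧸ dotPerp (bucketSpan E b) → (Fin t → ZMod 2) :=
    fun p => E (Quotient.out p) b
  have hg : ∀ x, g (Submodule.Quotient.mk x) = E x b := fun x =>
    eq_of_sub_mem_bucketSpan (out_sub_mem _ x)
  have hgs : Function.Surjective g := by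
    intro z
    obtain ⟨x, hx⟩ := hE z
    exact ⟨Submodule.Quotient.mk x, by rw [hg, ← hx]⟩
  have h1 := Nat.card_le_card_of_surjective g hgs
  rw [card_quotient_dotPerp, hcard] at h1
  have ht : finrank (ZMod 2) (bucketSpan E b) = t :=
    le_antisymm h ((Nat.pow_le_pow_iff_right (by norm_num)).1 h1)
  have hgb : Function.Bijective g := by
    refine (Nat.bijective_iff_surjective_and_card _).2 ⟨hgs, ?_⟩
    rw [card_quotient_dotPerp, hcard, ht]
  have hle : bucketSpan E b ≤ recoverable E {b} := by
    intro v hv x y hxy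
    have hxy' : E x b = E y b := hxy b (by simp)
    rw [← hg, ← hg] at hxy'
    have := (Submodule.Quotient.eq _).1 (hgb.1 hxy') v hv
    rwa [dotProduct_sub, sub_eq_zero] at this
  rw [← le_antisymm hle (recoverable_le_bucketSpan b)]
  exact ht

/-- All contents of a full pair occur, so bucket `b` takes all its values; if it depended on only
`t` requests, it would recover them all and be linear. -/
theorem lt_finrank_bucketSpan {b c : Fin m} (hbc : b ≠ c)
    (h : finrank (ZMod 2) (recoverable E {b, c}) = t * 2)
    (hb : finrank (ZMod 2) (recoverable E {b}) ≠ t) : t < finrank (ZMod 2) (bucketSpan E b) := by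
  by_contra hlt
  apply hb
  refine finrank_recoverable_of_surjective ?_ (not_lt.1 hlt)
  intro z
  have hS : finrank (ZMod 2) (recoverable E {b, c}) = t * ({b, c} : Finset (Fin m)).card := by
    rw [Finset.card_pair hbc, h]
  obtain ⟨x, hx⟩ := surjective_contents hS (fun _ => z)
  exact ⟨x, congrFun hx ⟨b, by simp⟩⟩

end Encoder

/-! ### Counting the points of subspaces outside a set already covered. -/

open Classical in
/-- The points of a subspace of a finite space, as a finset. -/
noncomputable def pts {M : Type*} [AddCommGroup M] [Module (ZMod 2) M] [Fintype M]
    (A : Submodule (ZMod 2) M) : Finset M := Finset.univ.filter (· ∈ A)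

section Points

variable {M : Type*} [AddCommGroup M] [Module (ZMod 2) M] [Fintype M] [DecidableEq M]

omit [DecidableEq M] in
@[simp] theorem mem_pts {A : Submodule (ZMod 2) M} {v : M} : v ∈ pts A ↔ v ∈ A := by
  simp [pts]

omit [DecidableEq M] in
theorem pts_mono {A B : Submodule (ZMod 2) M} (h : A ≤ B) : pts A ⊆ pts B := by
  intro v hv
  rw [mem_pts] at hv ⊢
  exact h hv

omit [DecidableEq M] in
theorem card_pts (A : Submodule (ZMod 2) M) : (pts A).card = 2 ^ finrank (ZMod 2) A := by
  have h : Nat.card A = (pts A).card := by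
    exact Nat.subtype_card (pts A) fun x => mem_pts
  rw [← h, Module.natCard_eq_pow_finrank (K := ZMod 2), Nat.card_zmod]

theorem pts_inter (A B : Submodule (ZMod 2) M) : pts A ∩ pts B = pts (A ⊓ B) := by
  ext v
  simp

omit [Fintype M] [DecidableEq M] in
theorem add_self_of_two (v : M) : v + v = 0 := by
  rw [← two_smul (ZMod 2) v, show (2 : ZMod 2) = 0 from rfl, zero_smul]

omit [Fintype M] [DecidableEq M] in
theorem add_add_cancel_of_two (v w : M) : v + (v + w) = w := by
  rw [← add_assoc, add_self_of_two, zero_add]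

omit [Fintype M] [DecidableEq M] in
theorem eq_of_add_eq_zero_of_two {v w : M} (h : v + w = 0) : v = w := by
  have := add_add_cancel_of_two v w
  rwa [h, add_zero] at this

theorem card_pts_sdiff_add_card_le {V : Submodule (ZMod 2) M} {X T : Finset M}
    (hX : X ⊆ pts V) (hT : X ⊆ T) : (pts V \ T).card + X.card ≤ 2 ^ finrank (ZMod 2) V := by
  rw [← card_pts, ← Finset.card_sdiff_add_card_eq_card hX]
  gcongr

theorem card_pts_sdiff_le_of_le {V A : Submodule (ZMod 2) M} {T : Finset M} {n k : ℕ}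
    (hA : A ≤ V) (hT : pts A ⊆ T) (hn : finrank (ZMod 2) V ≤ n) (hk : k ≤ finrank (ZMod 2) A) :
    (pts V \ T).card ≤ 2 ^ n - 2 ^ k := by
  have h1 := card_pts_sdiff_add_card_le (pts_mono hA) hT
  rw [card_pts] at h1
  have h2 : 2 ^ finrank (ZMod 2) V ≤ 2 ^ n := Nat.pow_le_pow_right (by norm_num) hn
  have h3 : 2 ^ k ≤ 2 ^ finrank (ZMod 2) A := Nat.pow_le_pow_right (by norm_num) hk
  omega

theorem card_pts_sdiff_le_of_sup {A B V : Submodule (ZMod 2) M} {T : Finset M}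
    (hV : V = A ⊔ B) (hA : pts A ⊆ T) (hB : pts B ⊆ T) :
    (pts V \ T).card + 2 ^ finrank (ZMod 2) A + 2 ^ finrank (ZMod 2) B
      ≤ 2 ^ finrank (ZMod 2) V + 2 ^ finrank (ZMod 2) (A ⊓ B : Submodule (ZMod 2) M) := by
  have h1 : (pts A ∪ pts B).card + (pts A ∩ pts B).card = (pts A).card + (pts B).card :=
    Finset.card_union_add_card_inter _ _
  rw [pts_inter, card_pts, card_pts, card_pts] at h1
  have h2 := card_pts_sdiff_add_card_le (V := V) (X := pts A ∪ pts B) (T := T)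
    (Finset.union_subset (pts_mono (hV ▸ le_sup_left)) (pts_mono (hV ▸ le_sup_right)))
    (Finset.union_subset hA hB)
  omega

omit [DecidableEq M] in
theorem finrank_sup_add (A B : Submodule (ZMod 2) M) :
    finrank (ZMod 2) (A ⊔ B : Submodule (ZMod 2) M)
      + finrank (ZMod 2) (A ⊓ B : Submodule (ZMod 2) M)
      = finrank (ZMod 2) A + finrank (ZMod 2) B :=
  Submodule.finrank_sup_add_finrank_inf_eq A B

/-- Two subspaces `A`, `B` of dimensions at least three that span a space of dimension four
leave at most six of its points uncovered. -/
theorem card_sup_sdiff_le_six {A B V : Submodule (ZMod 2) M} {T : Finset M}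
    (hV : V = A ⊔ B) (hA : pts A ⊆ T) (hB : pts B ⊆ T) (h4 : finrank (ZMod 2) V = 4)
    (ha : 3 ≤ finrank (ZMod 2) A) (hb : 3 ≤ finrank (ZMod 2) B) : (pts V \ T).card ≤ 6 := by
  have h1 := card_pts_sdiff_le_of_sup hV hA hB
  have h2 := finrank_sup_add A B
  rw [← hV, h4] at h2
  have h3 : finrank (ZMod 2) A ≤ 4 := (Submodule.finrank_mono (le_sup_left.trans_eq hV.symm)).trans_eq h4
  have h5 : finrank (ZMod 2) B ≤ 4 := (Submodule.finrank_mono (le_sup_right.trans_eq hV.symm)).trans_eq h4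
  generalize finrank (ZMod 2) (A ⊓ B : Submodule (ZMod 2) M) = i at *
  generalize finrank (ZMod 2) A = a at *
  generalize finrank (ZMod 2) B = b at *
  obtain rfl : i = a + b - 4 := by omega
  rw [h4] at h1
  interval_cases a <;> interval_cases b <;> norm_num at h1 ⊢ <;> omega

/-- If `A` has dimension three, `C` has dimension two and they span a space of dimension four, at
most six of its points lie outside both. -/
theorem card_sup_sdiff_le_six' {A C V : Submodule (ZMod 2) M} {T : Finset M}
    (hV : V = A ⊔ C) (hA : pts A ⊆ T) (hC : pts C ⊆ T) (h4 : finrank (ZMod 2) V = 4)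
    (ha : 3 ≤ finrank (ZMod 2) A) (hc : finrank (ZMod 2) C = 2) : (pts V \ T).card ≤ 6 := by
  have h1 := card_pts_sdiff_le_of_sup hV hA hC
  have h2 := finrank_sup_add A C
  rw [← hV, h4] at h2
  have h3 : finrank (ZMod 2) A ≤ 4 := (Submodule.finrank_mono (le_sup_left.trans_eq hV.symm)).trans_eq h4
  generalize finrank (ZMod 2) (A ⊓ C : Submodule (ZMod 2) M) = i at *
  generalize finrank (ZMod 2) A = a at *
  obtain rfl : i = a + 2 - 4 := by omega
  rw [h4, hc] at h1
  interval_cases a <;> norm_num at h1 ⊢ <;> omega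

/-- A space of dimension at most three that spans at most six dimensions with a space `B` of
dimension four has at most six points outside `B`. -/
theorem card_sdiff_le_six_of_sup {A B : Submodule (ZMod 2) M} {T : Finset M}
    (hB : pts B ⊆ T) (ha : finrank (ZMod 2) A ≤ 3) (hb : finrank (ZMod 2) B = 4)
    (h6 : finrank (ZMod 2) (A ⊔ B : Submodule (ZMod 2) M) ≤ 6) : (pts A \ T).card ≤ 6 := by
  have h1 := card_pts_sdiff_add_card_le (V := A) (X := pts (A ⊓ B)) (T := T)
    (pts_mono inf_le_left) ((pts_mono inf_le_right).trans hB)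
  rw [card_pts] at h1
  have h2 := finrank_sup_add A B
  generalize finrank (ZMod 2) (A ⊓ B : Submodule (ZMod 2) M) = i at *
  generalize finrank (ZMod 2) A = a at *
  have h3 : 2 ^ 0 ≤ 2 ^ i := Nat.pow_le_pow_right (by norm_num) (by omega)
  interval_cases a <;> norm_num at h1 ⊢
  · omega
  · omega
  · omega
  · have h4 : 2 ^ 1 ≤ 2 ^ i := Nat.pow_le_pow_right (by norm_num) (by omega)
    omega

omit [DecidableEq M] in
theorem finrank_inf_pos_of_ne_bot {A : Submodule (ZMod 2) M} (h : A ≠ ⊥) :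
    1 ≤ finrank (ZMod 2) A := Submodule.one_le_finrank_iff.2 h

/-- The worst case is two disjoint lines: 16 - 4 - 4 + 1 = 9. -/
theorem card_lines_sdiff_le_nine {A B : Submodule (ZMod 2) M} {T : Finset M}
    (hA : pts A ⊆ T) (hB : pts B ⊆ T) (ha : finrank (ZMod 2) A = 2)
    (hb : finrank (ZMod 2) B = 2) : (pts (A ⊔ B) \ T).card ≤ 9 := by
  have h1 := card_pts_sdiff_le_of_sup rfl hA hB
  have h2 := finrank_sup_add A B
  rw [ha, hb] at h1 h2
  generalize finrank (ZMod 2) (A ⊓ B : Submodule (ZMod 2) M) = i at *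
  generalize finrank (ZMod 2) (A ⊔ B : Submodule (ZMod 2) M) = j at *
  have hj : j ≤ 4 := by omega
  obtain rfl : i = 4 - j := by omega
  interval_cases j <;> norm_num at h1 ⊢ <;> omega

theorem card_meeting_lines_sdiff_le_two {A B : Submodule (ZMod 2) M} {T : Finset M}
    (hA : pts A ⊆ T) (hB : pts B ⊆ T) (ha : finrank (ZMod 2) A = 2)
    (hb : finrank (ZMod 2) B = 2) (hAB : A ⊓ B ≠ ⊥) : (pts (A ⊔ B) \ T).card ≤ 2 := by
  have h1 := card_pts_sdiff_le_of_sup rfl hA hB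
  have h2 := finrank_sup_add A B
  have h3 := finrank_inf_pos_of_ne_bot hAB
  have h4 : finrank (ZMod 2) (A ⊓ B : Submodule (ZMod 2) M) ≤ 2 :=
    (Submodule.finrank_mono inf_le_left).trans_eq ha
  rw [ha, hb] at h1 h2
  generalize finrank (ZMod 2) (A ⊓ B : Submodule (ZMod 2) M) = i at *
  generalize finrank (ZMod 2) (A ⊔ B : Submodule (ZMod 2) M) = j at *
  obtain rfl : j = 4 - i := by omega
  interval_cases i <;> norm_num at h1 ⊢ <;> omega

/-- A point `p` common to `A` and `C` gives a plane, spanned by `p` and `D`, inside the covered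
space `C ⊔ D`. If `A` and `D` are disjoint, this plane meets `A` in `p` only, leaving 16 - 4 - 8 + 2
= 6 points; otherwise `A ⊔ D` has at most eight points, four of them on `A`. -/
theorem card_lines_sdiff_le_six_of_meeting {A C D : Submodule (ZMod 2) M} {T : Finset M}
    (hA : pts A ⊆ T) (hCD : pts (C ⊔ D) ⊆ T) (ha : finrank (ZMod 2) A = 2)
    (hd : finrank (ZMod 2) D = 2) (hAC : A ⊓ C ≠ ⊥) : (pts (A ⊔ D) \ T).card ≤ 6 := by
  by_cases hAD : A ⊓ D = ⊥
  · obtain ⟨p, hp, hp0⟩ := Submodule.exists_mem_ne_zero_of_ne_bot hAC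
    have hpD : span (ZMod 2) {p} ⊓ D = ⊥ := by
      rw [eq_bot_iff, ← hAD]
      exact inf_le_inf_right _ ((span_singleton_le_iff_mem _ _).2 hp.1)
    have h1 := finrank_sup_add (span (ZMod 2) {p}) D
    rw [hpD, finrank_bot, finrank_span_singleton hp0, hd] at h1
    have h2 : A ⊔ D = A ⊔ (span (ZMod 2) {p} ⊔ D) := by
      rw [← sup_assoc, sup_eq_left.2 ((span_singleton_le_iff_mem _ _).2 hp.1)]
    have h3 := finrank_sup_add A D
    rw [hAD, finrank_bot, ha, hd] at h3
    have h4 := finrank_sup_add A (span (ZMod 2) {p} ⊔ D)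
    rw [← h2] at h4
    have h5 := card_pts_sdiff_le_of_sup h2 hA
      ((pts_mono (sup_le_sup_right ((span_singleton_le_iff_mem _ _).2 hp.2) D)).trans hCD)
    have h6 : finrank (ZMod 2) (A ⊓ (span (ZMod 2) {p} ⊔ D) : Submodule (ZMod 2) M) = 1 := by
      omega
    rw [h6, ha, show finrank (ZMod 2) (A ⊔ D : Submodule (ZMod 2) M) = 4 by omega,
      show finrank (ZMod 2) (span (ZMod 2) {p} ⊔ D : Submodule (ZMod 2) M) = 3 by omega] at h5
    omega
  · have h1 := finrank_sup_add A D
    have h2 := finrank_inf_pos_of_ne_bot hAD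
    have := card_pts_sdiff_le_of_le (V := A ⊔ D) (A := A) (T := T) (n := 3) (k := 2) le_sup_left
      hA (by omega) (by omega)
    omega

omit [Fintype M] [AddCommGroup M] [Module (ZMod 2) M] in
-- The accounting rule behind all later bounds: each new set is charged only for its points outside
-- the base.
theorem card_union_biUnion_le {ι : Type*} (B : Finset M) (s : Finset ι) (f : ι → Finset M)
    (n : ι → ℕ) (h : ∀ i ∈ s, (f i \ B).card ≤ n i) :
    (B ∪ s.biUnion f).card ≤ B.card + ∑ i ∈ s, n i := by
  have h1 : B ∪ s.biUnion f ⊆ B ∪ s.biUnion fun i => f i \ B := by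
    intro v hv
    simp only [Finset.mem_union, Finset.mem_biUnion, Finset.mem_sdiff] at hv ⊢
    by_cases hB : v ∈ B
    · exact Or.inl hB
    · obtain hv | ⟨i, hi, hv⟩ := hv
      · exact Or.inl hv
      · exact Or.inr ⟨i, hi, hv, hB⟩
  refine (Finset.card_le_card h1).trans ((Finset.card_union_le _ _).trans ?_)
  gcongr
  exact Finset.card_biUnion_le.trans (Finset.sum_le_sum h)

omit [Fintype M] [AddCommGroup M] [Module (ZMod 2) M] in
theorem card_union_biUnion_le_mul {ι : Type*} (B : Finset M) (s : Finset ι) (f : ι → Finset M)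
    (n : ℕ) (h : ∀ i ∈ s, (f i \ B).card ≤ n) :
    (B ∪ s.biUnion f).card ≤ B.card + s.card * n := by
  simpa using card_union_biUnion_le B s f (fun _ => n) h

omit [DecidableEq M] [Fintype M] in
theorem exists_le_finrank_eq [Module.Finite (ZMod 2) M] {A : Submodule (ZMod 2) M} {n : ℕ} (hA : finrank (ZMod 2) A ≤ n)
    (hn : n ≤ finrank (ZMod 2) M) : ∃ W, A ≤ W ∧ finrank (ZMod 2) W = n := by
  induction n, hA using Nat.le_induction with
  | base => exact ⟨A, le_rfl, rfl⟩
  | succ k hk ih =>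
    obtain ⟨W, hAW, hW⟩ := ih (by omega)
    have hlt : W < ⊤ := by
      rw [lt_top_iff_ne_top]
      rintro rfl
      rw [finrank_top] at hW
      omega
    obtain ⟨v, -, hv⟩ := SetLike.exists_of_lt hlt
    refine ⟨W ⊔ span (ZMod 2) {v}, hAW.trans le_sup_left, ?_⟩
    have h0 : v ≠ 0 := fun h => hv (h ▸ W.zero_mem)
    have h1 := Submodule.finrank_sup_add_finrank_inf_eq W (span (ZMod 2) {v})
    have h2 : W ⊓ span (ZMod 2) {v} = ⊥ := by
      rw [inf_comm, ← disjoint_iff]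
      exact (Submodule.disjoint_span_singleton' h0).2 hv |>.symm
    rw [h2, finrank_bot, finrank_span_singleton h0] at h1
    omega

end Points

/-! ### Families of lines and the points covered by the spans of their pairs. -/

section LineFamilies

variable {M : Type*} [AddCommGroup M] [Module (ZMod 2) M] [Fintype M] [DecidableEq M]
  {ι : Type*} [DecidableEq ι]

open Classical in
/-- The points covered by the spans of at most two members of the family `W` over `K`. -/
noncomputable def pairCover (W : ι → Submodule (ZMod 2) M) (K : Finset ι) : Finset M :=
  Finset.univ.filter fun v => v = 0 ∨ ∃ i ∈ K, ∃ j ∈ K, v ∈ W i ⊔ W j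

variable {W : ι → Submodule (ZMod 2) M} {K : Finset ι}

omit [DecidableEq ι] in
theorem mem_pairCover {v : M} :
    v ∈ pairCover W K ↔ v = 0 ∨ ∃ i ∈ K, ∃ j ∈ K, v ∈ W i ⊔ W j := by
  simp [pairCover]

omit [DecidableEq ι] in
theorem zero_mem_pairCover : (0 : M) ∈ pairCover W K := mem_pairCover.2 (Or.inl rfl)

omit [DecidableEq ι] in
theorem pts_sup_subset_pairCover {i j : ι} (hi : i ∈ K) (hj : j ∈ K) :
    pts (W i ⊔ W j) ⊆ pairCover W K := by
  intro v hv
  exact mem_pairCover.2 (Or.inr ⟨i, hi, j, hj, mem_pts.1 hv⟩)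

omit [DecidableEq ι] in
theorem pts_subset_pairCover {i : ι} (hi : i ∈ K) : pts (W i) ⊆ pairCover W K :=
  (pts_mono le_sup_left).trans (pts_sup_subset_pairCover hi hi)

theorem pairCover_insert_subset (W : ι → Submodule (ZMod 2) M) (K : Finset ι) (k : ι) :
    pairCover W (insert k K) ⊆
      (pairCover W K ∪ pts (W k)) ∪ K.biUnion fun i => pts (W k ⊔ W i) := by
  intro v hv
  obtain rfl | ⟨i, hi, j, hj, h⟩ := mem_pairCover.1 hv
  · simp [zero_mem_pairCover]
  · simp only [Finset.mem_union, Finset.mem_biUnion, mem_pts]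
    obtain rfl | hi' := Finset.mem_insert.1 hi <;> obtain rfl | hj' := Finset.mem_insert.1 hj
    · rw [sup_idem] at h
      exact Or.inl (Or.inr h)
    · exact Or.inr ⟨j, hj', h⟩
    · exact Or.inr ⟨i, hi', sup_comm (W i) (W j) ▸ h⟩
    · exact Or.inl (Or.inl (mem_pairCover.2 (Or.inr ⟨i, hi', j, hj', h⟩)))

theorem card_pairCover_insert_le {k : ι} (hK : ∀ i ∈ K, finrank (ZMod 2) (W i) = 2)
    (hk : finrank (ZMod 2) (W k) = 2) :
    (pairCover W (insert k K)).card ≤ (pairCover W K).card + 3 + 9 * K.card := by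
  have h1 : (pts (W k) \ pairCover W K).card ≤ 3 :=
    card_pts_sdiff_le_of_le (A := ⊥) (n := 2) (k := 0) bot_le
      (by intro v hv; rw [(mem_bot _).1 (mem_pts.1 hv)]; exact zero_mem_pairCover)
      hk.le (Nat.zero_le _)
  have h2 : (pairCover W K ∪ pts (W k)).card ≤ (pairCover W K).card + 3 := by
    rw [← Finset.union_sdiff_self_eq_union]
    exact (Finset.card_union_le _ _).trans (by omega)
  have h3 := card_union_biUnion_le_mul (pairCover W K ∪ pts (W k)) K
    (fun i => pts (W k ⊔ W i)) 9 fun i hi =>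
      card_lines_sdiff_le_nine Finset.subset_union_right
        ((pts_subset_pairCover hi).trans Finset.subset_union_left) hk (hK i hi)
  have h4 := Finset.card_le_card (pairCover_insert_subset W K k)
  omega

/-- The meeting point saves everywhere: the new line adds two points, its span with `W i₀` two more,
and its span with any other line six, because the plane joining the meeting point to that line is
already covered. -/
theorem card_pairCover_insert_le_of_meeting {k i₀ : ι} (hi₀ : i₀ ∈ K)
    (hK : ∀ i ∈ K, finrank (ZMod 2) (W i) = 2)
    (hk : finrank (ZMod 2) (W k) = 2) (hmeet : W k ⊓ W i₀ ≠ ⊥) :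
    (pairCover W (insert k K)).card ≤ (pairCover W K).card + 4 + 6 * (K.card - 1) := by
  have h1 : (pts (W k) \ pairCover W K).card ≤ 2 :=
    card_pts_sdiff_le_of_le (A := W k ⊓ W i₀) (n := 2) (k := 1) inf_le_left
      ((pts_mono inf_le_right).trans (pts_subset_pairCover hi₀)) hk.le
      (finrank_inf_pos_of_ne_bot hmeet)
  have h2 : (pairCover W K ∪ pts (W k)).card ≤ (pairCover W K).card + 2 := by
    rw [← Finset.union_sdiff_self_eq_union]
    exact (Finset.card_union_le _ _).trans (by omega)
  have h3 := card_union_biUnion_le (pairCover W K ∪ pts (W k)) K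
    (fun i => pts (W k ⊔ W i)) (fun i => if i = i₀ then 2 else 6) (by
      intro i hi
      have hsub : pts (W k) ⊆ pairCover W K ∪ pts (W k) := Finset.subset_union_right
      split_ifs with h
      · subst h
        exact card_meeting_lines_sdiff_le_two hsub
          ((pts_subset_pairCover hi).trans Finset.subset_union_left) hk (hK i hi) hmeet
      · exact card_lines_sdiff_le_six_of_meeting hsub
          ((pts_sup_subset_pairCover hi₀ hi).trans Finset.subset_union_left) hk (hK i hi) hmeet)
  have h4 := Finset.card_le_card (pairCover_insert_subset W K k)
  rw [← Finset.add_sum_erase K _ hi₀, if_pos rfl,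
    Finset.sum_congr rfl (fun i hi => if_neg (Finset.ne_of_mem_erase hi)), Finset.sum_const,
    Finset.card_erase_of_mem hi₀, smul_eq_mul] at h3
  omega

theorem card_pairCover_le (hK : ∀ i ∈ K, finrank (ZMod 2) (W i) = 2) :
    (pairCover W K).card ≤ 1 + 3 * K.card + 9 * K.card.choose 2 := by
  induction K using Finset.induction_on with
  | empty =>
    have : pairCover W ∅ ⊆ {0} := by
      intro v hv
      simpa [mem_pairCover] using hv
    simpa using Finset.card_le_card this
  | insert k K hk ih =>
    have h1 := ih fun i hi => hK i (Finset.mem_insert_of_mem hi)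
    have h2 := card_pairCover_insert_le (W := W) (k := k)
      (fun i hi => hK i (Finset.mem_insert_of_mem hi)) (hK k (Finset.mem_insert_self _ _))
    rw [Finset.card_insert_of_notMem hk, Nat.choose_succ_succ' _ 1, Nat.choose_one_right]
    simp only [Nat.reduceAdd] at *
    omega

/-- If two members of a family of lines meet, the family covers few points. -/
theorem card_pairCover_le_of_meeting (hK : ∀ i ∈ K, finrank (ZMod 2) (W i) = 2) {i j : ι}
    (hi : i ∈ K) (hj : j ∈ K) (hij : i ≠ j) (hmeet : W i ⊓ W j ≠ ⊥) :
    (pairCover W K).card ≤ (pairCover W (K.erase i)).card + 4 + 6 * (K.card - 2) := by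
  have := card_pairCover_insert_le_of_meeting (K := K.erase i) (k := i) (i₀ := j) (W := W)
    (Finset.mem_erase.2 ⟨hij.symm, hj⟩) (fun l hl => hK l (Finset.mem_of_mem_erase hl))
    (hK i hi) hmeet
  rwa [Finset.insert_erase hi, Finset.card_erase_of_mem hi, Nat.sub_sub] at this

omit [Fintype M] [DecidableEq M] in
theorem edge_sup {e : Finset ι} {i j : ι} (he : e = {i, j}) : e.sup W = W i ⊔ W j := by
  rw [he, Finset.sup_insert, Finset.sup_singleton]

/-- The points on the span of the pair `e` of lines that are on neither line. -/
noncomputable def properPts (W : ι → Submodule (ZMod 2) M) (e : Finset ι) : Finset M :=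
  pts (e.sup W) \ (e.biUnion fun i => pts (W i))

omit [DecidableEq ι] in
theorem mem_properPts {e : Finset ι} {v : M} :
    v ∈ properPts W e ↔ v ∈ e.sup W ∧ ∀ i ∈ e, v ∉ W i := by
  simp [properPts]

theorem card_properPts_le {e : Finset ι} (he : e.card = 2)
    (hK : ∀ i ∈ e, finrank (ZMod 2) (W i) = 2) : (properPts W e).card ≤ 9 := by
  obtain ⟨i, j, -, h⟩ := Finset.card_eq_two.1 he
  rw [properPts, edge_sup h]
  refine card_lines_sdiff_le_nine ?_ ?_ (hK i (by simp [h])) (hK j (by simp [h]))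
  · exact Finset.subset_biUnion_of_mem (fun i => pts (W i)) (by simp [h])
  · exact Finset.subset_biUnion_of_mem (fun i => pts (W i)) (by simp [h])

theorem card_pairCover_le_properPts (hK : ∀ i ∈ K, finrank (ZMod 2) (W i) = 2) :
    (pairCover W K).card ≤
      1 + 3 * K.card + ((K.powersetCard 2).biUnion (properPts W)).card := by
  have h1 : pairCover W K ⊆
      ({0} ∪ K.biUnion fun i => pts (W i)) ∪ (K.powersetCard 2).biUnion (properPts W) := by
    intro v hv
    simp only [Finset.mem_union, Finset.mem_biUnion, Finset.mem_singleton, mem_pts]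
    obtain h | ⟨i, hi, j, hj, h⟩ := mem_pairCover.1 hv
    · exact Or.inl (Or.inl h)
    · by_cases hvi : v ∈ W i
      · exact Or.inl (Or.inr ⟨i, hi, hvi⟩)
      by_cases hvj : v ∈ W j
      · exact Or.inl (Or.inr ⟨j, hj, hvj⟩)
      have hij : i ≠ j := by
        rintro rfl
        rw [sup_idem] at h
        exact hvi h
      refine Or.inr ⟨{i, j}, ?_, ?_⟩
      · rw [Finset.mem_powersetCard]
        exact ⟨by simp [Finset.insert_subset_iff, hi, hj], Finset.card_pair hij⟩
      · rw [mem_properPts, edge_sup rfl]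
        simpa [h] using ⟨hvi, hvj⟩
  have h2 := card_union_biUnion_le_mul {0} K (fun i => pts (W i)) 3 fun i hi =>
    card_pts_sdiff_le_of_le (A := ⊥) (n := 2) (k := 0) bot_le
      (by intro v hv; rw [(mem_bot _).1 (mem_pts.1 hv)]; simp) (hK i hi).le (Nat.zero_le _)
  rw [Finset.card_singleton] at h2
  have h3 := Finset.card_le_card h1
  have h4 := Finset.card_union_le ({0} ∪ K.biUnion fun i => pts (W i))
    ((K.powersetCard 2).biUnion (properPts W))
  omega

/-- For a family of lines in which any three are independent, in dimension seven: a point is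
proper for pairwise disjoint pairs, and any two disjoint pairs share a proper point. -/
theorem three_mul_card_biUnion_properPts_le (hM : finrank (ZMod 2) M = 7) (hcard : K.card ≤ 7)
    (hK : ∀ i ∈ K, finrank (ZMod 2) (W i) = 2)
    (h3 : ∀ i ∈ K, ∀ j ∈ K, ∀ k ∈ K, i ≠ j → k ≠ i → k ≠ j → W k ⊓ (W i ⊔ W j) = ⊥)
    (h2 : ∀ i ∈ K, ∀ j ∈ K, i ≠ j → W i ⊓ W j = ⊥) :
    3 * ((K.powersetCard 2).biUnion (properPts W)).card
      + K.card.choose 2 * (K.card - 2).choose 2 ≤ 27 * K.card.choose 2 := by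
  classical
  set P := K.powersetCard 2 with hP
  set X := P.biUnion (properPts W) with hX
  have hsub : ∀ e ∈ P, ∀ i ∈ e, i ∈ K := fun e he i hi => (Finset.mem_powersetCard.1 he).1 hi
  -- If pairs `{i, j}` and `{i, k}` shared a proper point, its component on `W k` would lie in `W i
  -- ⊔ W j`, hence vanish, and the point would be on `W i`.
  have hdisj : ∀ e ∈ P, ∀ f ∈ P, e ≠ f → ∀ v, v ∈ properPts W e → v ∈ properPts W f →
      Disjoint e f := by
    intro e he f hf hef v hve hvf
    by_contra hnd
    obtain ⟨i, hie, hif⟩ := Finset.not_disjoint_iff.1 hnd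
    obtain ⟨j, hj⟩ := Finset.card_eq_one.1 (show (e.erase i).card = 1 by
      rw [Finset.card_erase_of_mem hie, (Finset.mem_powersetCard.1 he).2])
    obtain ⟨k, hk⟩ := Finset.card_eq_one.1 (show (f.erase i).card = 1 by
      rw [Finset.card_erase_of_mem hif, (Finset.mem_powersetCard.1 hf).2])
    have he' : e = {i, j} := by rw [← Finset.insert_erase hie, hj]
    have hf' : f = {i, k} := by rw [← Finset.insert_erase hif, hk]
    have hji : j ≠ i := Finset.ne_of_mem_erase (hj ▸ Finset.mem_singleton_self j)
    have hki : k ≠ i := Finset.ne_of_mem_erase (hk ▸ Finset.mem_singleton_self k)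
    have hkj : k ≠ j := by
      rintro rfl
      exact hef (he'.trans hf'.symm)
    have hjK : j ∈ K := hsub e he j (by simp [he'])
    have hkK : k ∈ K := hsub f hf k (by simp [hf'])
    rw [mem_properPts, edge_sup he'] at hve
    rw [mem_properPts, edge_sup hf'] at hvf
    obtain ⟨a, ha, b, hb, hab⟩ := Submodule.mem_sup.1 hvf.1
    have hb' : b ∈ W i ⊔ W j := by
      have : b = v - a := by rw [← hab]; abel
      rw [this]
      exact sub_mem hve.1 (Submodule.mem_sup_left ha)
    have hb0 : b = 0 := by
      have : b ∈ W k ⊓ (W i ⊔ W j) := ⟨hb, hb'⟩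
      rwa [h3 i (hsub e he i hie) j hjK k hkK hji.symm hki hkj, mem_bot] at this
    rw [hb0, add_zero] at hab
    exact hve.2 i hie (hab ▸ ha)
  -- Two spans of dimension four meet in dimension seven. By independence of triples, a nonzero
  -- common point is on none of the four lines.
  have hmeet : ∀ e ∈ P, ∀ f ∈ P, Disjoint e f → (properPts W e ∩ properPts W f).Nonempty := by
    intro e he f hf hd
    obtain ⟨i, j, hij, he'⟩ := Finset.card_eq_two.1 (Finset.mem_powersetCard.1 he).2
    obtain ⟨k, l, hkl, hf'⟩ := Finset.card_eq_two.1 (Finset.mem_powersetCard.1 hf).2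
    have hiK : i ∈ K := hsub e he i (by simp [he'])
    have hjK : j ∈ K := hsub e he j (by simp [he'])
    have hkK : k ∈ K := hsub f hf k (by simp [hf'])
    have hlK : l ∈ K := hsub f hf l (by simp [hf'])
    have hik : i ≠ k := Finset.disjoint_iff_ne.1 hd i (by simp [he']) k (by simp [hf'])
    have hil : i ≠ l := Finset.disjoint_iff_ne.1 hd i (by simp [he']) l (by simp [hf'])
    have hjk : j ≠ k := Finset.disjoint_iff_ne.1 hd j (by simp [he']) k (by simp [hf'])
    have hjl : j ≠ l := Finset.disjoint_iff_ne.1 hd j (by simp [he']) l (by simp [hf'])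
    have d1 := finrank_sup_add (W i) (W j)
    rw [h2 i hiK j hjK hij, finrank_bot, hK i hiK, hK j hjK] at d1
    have d2 := finrank_sup_add (W k) (W l)
    rw [h2 k hkK l hlK hkl, finrank_bot, hK k hkK, hK l hlK] at d2
    have d3 := finrank_sup_add (W i ⊔ W j) (W k ⊔ W l)
    have d4 := Submodule.finrank_le (W i ⊔ W j ⊔ (W k ⊔ W l))
    have hne : (W i ⊔ W j) ⊓ (W k ⊔ W l) ≠ ⊥ := by
      intro h
      rw [h, finrank_bot] at d3
      omega
    obtain ⟨v, hv, hv0⟩ := Submodule.exists_mem_ne_zero_of_ne_bot hne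
    have aux : ∀ x ∈ K, ∀ y ∈ K, ∀ z ∈ K, x ≠ y → z ≠ x → z ≠ y → v ∈ W x ⊔ W y → v ∉ W z := by
      intro x hx y hy z hz hxy hzx hzy hv1 hv2
      have : v ∈ W z ⊓ (W x ⊔ W y) := ⟨hv2, hv1⟩
      rw [h3 x hx y hy z hz hxy hzx hzy, mem_bot] at this
      exact hv0 this
    refine ⟨v, Finset.mem_inter.2 ⟨?_, ?_⟩⟩
    · rw [mem_properPts, edge_sup he']
      refine ⟨hv.1, fun x hx => ?_⟩
      rw [he', Finset.mem_insert, Finset.mem_singleton] at hx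
      obtain rfl | rfl := hx
      · exact aux k hkK l hlK x hiK hkl hik hil hv.2
      · exact aux k hkK l hlK x hjK hkl hjk hjl hv.2
    · rw [mem_properPts, edge_sup hf']
      refine ⟨hv.2, fun x hx => ?_⟩
      rw [hf', Finset.mem_insert, Finset.mem_singleton] at hx
      obtain rfl | rfl := hx
      · exact aux i hiK j hjK x hkK hij hik.symm hjk.symm hv.1
      · exact aux i hiK j hjK x hlK hij hil.symm hjl.symm hv.1
  let D : Finset (Finset ι × Finset ι) := (P ×ˢ P).filter fun q => Disjoint q.1 q.2
  -- A point proper for `n` pairs uses `2 n ≤ 7` lines, so `1 ≤ n ≤ 3`. There `(n - 1)(n - 3) ≤ 0`,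
  -- that is `3 + n (n - 1) ≤ 3 n`, and `n (n - 1)` bounds the ordered pairs in `D` sharing the
  -- point.
  have hpoint : ∀ v ∈ X, 3 + (D.filter fun q => v ∈ properPts W q.1 ∩ properPts W q.2).card
      ≤ 3 * (P.filter fun e => v ∈ properPts W e).card := by
    intro v hv
    set S := P.filter fun e => v ∈ properPts W e with hS
    have hSpos : 1 ≤ S.card := by
      obtain ⟨e, he, hve⟩ := Finset.mem_biUnion.1 hv
      exact Finset.card_pos.2 ⟨e, Finset.mem_filter.2 ⟨he, hve⟩⟩
    have hDS : (D.filter fun q => v ∈ properPts W q.1 ∩ properPts W q.2) ⊆ S.offDiag := by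
      intro q hq
      simp only [D, Finset.mem_filter, Finset.mem_product, Finset.mem_inter] at hq
      obtain ⟨⟨⟨hq1, hq2⟩, hd⟩, hv1, hv2⟩ := hq
      rw [Finset.mem_offDiag]
      refine ⟨Finset.mem_filter.2 ⟨hq1, hv1⟩, Finset.mem_filter.2 ⟨hq2, hv2⟩, ?_⟩
      intro h
      rw [← h, disjoint_self, Finset.bot_eq_empty] at hd
      have := (Finset.mem_powersetCard.1 hq1).2
      rw [hd] at this
      simp at this
    have h4 := Finset.card_le_card hDS
    rw [Finset.offDiag_card] at h4
    have h5 : (S.biUnion id).card = S.card * 2 := by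
      rw [Finset.card_biUnion]
      · exact Finset.sum_const_nat fun e he =>
          (Finset.mem_powersetCard.1 (Finset.mem_filter.1 he).1).2
      · intro e he f hf hef
        exact hdisj e (Finset.mem_filter.1 he).1 f (Finset.mem_filter.1 hf).1 hef v
          (Finset.mem_filter.1 he).2 (Finset.mem_filter.1 hf).2
    have h6 : (S.biUnion id).card ≤ K.card := by
      apply Finset.card_le_card
      intro i hi
      obtain ⟨e, he, hie⟩ := Finset.mem_biUnion.1 hi
      exact hsub e (Finset.mem_filter.1 he).1 i hie
    have h7 : S.card ≤ 3 := by omega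
    have h8 : 3 + (S.card * S.card - S.card) ≤ 3 * S.card := by
      clear h4 h5 h6
      generalize S.card = n at hSpos h7 ⊢
      interval_cases n <;> norm_num
    exact (Nat.add_le_add_left h4 3).trans h8
  -- Double counting of incidences, needed once for pairs of lines and once for ordered pairs of
  -- them.
  have hswap : ∀ {κ : Type _} (Q : Finset κ) (f : κ → Finset M), (∀ q ∈ Q, f q ⊆ X) →
      ∑ v ∈ X, (Q.filter fun q => v ∈ f q).card = ∑ q ∈ Q, (f q).card := by
    intro κ Q f hf
    simp only [Finset.card_filter]
    rw [Finset.sum_comm]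
    refine Finset.sum_congr rfl fun q hq => ?_
    rw [← Finset.card_filter]
    congr 1
    ext v
    simp only [Finset.mem_filter]
    exact ⟨fun h => h.2, fun h => ⟨hf q hq h, h⟩⟩
  have hsum := Finset.sum_le_sum hpoint
  rw [Finset.sum_add_distrib, ← Finset.mul_sum, Finset.sum_const, smul_eq_mul,
    hswap P (properPts W) (fun e he => Finset.subset_biUnion_of_mem _ he),
    hswap D (fun q => properPts W q.1 ∩ properPts W q.2) (fun q hq =>
      Finset.inter_subset_left.trans (Finset.subset_biUnion_of_mem _
        (Finset.mem_product.1 (Finset.mem_filter.1 hq).1).1))] at hsum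
  have hPcard : P.card = K.card.choose 2 := Finset.card_powersetCard _ _
  have hQ : ∑ e ∈ P, (properPts W e).card ≤ P.card * 9 := by
    apply Finset.sum_le_card_nsmul
    intro e he
    exact card_properPts_le (Finset.mem_powersetCard.1 he).2 fun i hi => hK i (hsub e he i hi)
  have hDsum : D.card ≤ ∑ q ∈ D, (properPts W q.1 ∩ properPts W q.2).card := by
    rw [Finset.card_eq_sum_ones]
    apply Finset.sum_le_sum
    intro q hq
    simp only [D, Finset.mem_filter, Finset.mem_product] at hq
    exact Finset.card_pos.2 (hmeet q.1 hq.1.1 q.2 hq.1.2 hq.2)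
  have hDcard : K.card.choose 2 * (K.card - 2).choose 2 = D.card := by
    have : D = P.biUnion fun e => ({e} : Finset (Finset ι)) ×ˢ ((K \ e).powersetCard 2) := by
      ext q
      simp only [D, hP, Finset.mem_filter, Finset.mem_product, Finset.mem_biUnion,
        Finset.mem_singleton, Finset.mem_powersetCard, Finset.subset_sdiff]
      constructor
      · rintro ⟨⟨h1, h2⟩, h3⟩
        exact ⟨q.1, h1, rfl, ⟨h2.1, h3.symm⟩, h2.2⟩
      · rintro ⟨e, h1, h2, ⟨h3, h4⟩, h5⟩
        rw [h2]
        exact ⟨⟨h1, h3, h5⟩, h4.symm⟩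
    rw [this, Finset.card_biUnion]
    · rw [← hPcard, Finset.card_eq_sum_ones P, Finset.sum_mul]
      refine Finset.sum_congr rfl fun e he => ?_
      rw [Finset.card_product, Finset.card_singleton, Finset.card_powersetCard,
        Finset.card_sdiff_of_subset (Finset.mem_powersetCard.1 he).1,
        (Finset.mem_powersetCard.1 he).2]
    · intro e _ f _ hef
      refine Finset.disjoint_left.2 ?_
      rintro q hq hq'
      simp only [Finset.mem_product, Finset.mem_singleton] at hq hq'
      exact hef (hq.1.symm.trans hq'.1)
  rw [hPcard] at hQ
  omega

end LineFamilies

/-! ### Six lines, three of which carry points with sum zero. -/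

section DependentTriple

variable {M : Type*} [AddCommGroup M] [Module (ZMod 2) M] [Fintype M] [DecidableEq M]

/-- Three pairwise disjoint lines with a dependency cover few points of their span. -/
theorem card_pairCover_dependent_le {ι : Type*} [DecidableEq ι] {W : ι → Submodule (ZMod 2) M}
    {i j k : ι} (hi : finrank (ZMod 2) (W i) = 2) (hj : finrank (ZMod 2) (W j) = 2)
    (hk : finrank (ZMod 2) (W k) = 2) (hij : W i ⊓ W j = ⊥) (hik : W i ⊓ W k = ⊥)
    (hjk : W j ⊓ W k = ⊥) {a b c : M} (ha : a ∈ W i) (hb : b ∈ W j) (hc : c ∈ W k)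
    (hb0 : b ≠ 0) (hc0 : c ≠ 0) (habc : a + b + c = 0) :
    (pairCover W {i, j, k}).card ≤ 28 := by
  have hcab : c = a + b := (eq_of_add_eq_zero_of_two habc).symm
  have hbac : b = a + c := by rw [hcab, add_add_cancel_of_two]
  have hc' : c ∈ W i ⊔ W j := hcab ▸ add_mem (mem_sup_left ha) (mem_sup_right hb)
  have hb' : b ∈ W i ⊔ W k := hbac ▸ add_mem (mem_sup_left ha) (mem_sup_right hc)
  have hsup : ∀ {X Y : Submodule (ZMod 2) M} {y : M}, X ⊓ Y = ⊥ → finrank (ZMod 2) X = 2 →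
      y ∈ Y → y ≠ 0 → finrank (ZMod 2) (X ⊔ span (ZMod 2) {y} : Submodule (ZMod 2) M) = 3 := by
    intro X Y y hXY hX hy hy0
    have h1 := finrank_sup_add X (span (ZMod 2) {y})
    have h2 : X ⊓ span (ZMod 2) {y} = ⊥ := by
      rw [eq_bot_iff, ← hXY]
      exact inf_le_inf_left _ ((span_singleton_le_iff_mem _ _).2 hy)
    rw [h2, finrank_bot, finrank_span_singleton hy0, hX] at h1
    omega
  have h4 : ∀ {X Y : Submodule (ZMod 2) M}, X ⊓ Y = ⊥ → finrank (ZMod 2) X = 2 →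
      finrank (ZMod 2) Y = 2 → finrank (ZMod 2) (X ⊔ Y : Submodule (ZMod 2) M) = 4 := by
    intro X Y hXY hX hY
    have h1 := finrank_sup_add X Y
    rw [hXY, finrank_bot, hX, hY] at h1
    omega
  have hcover : pairCover W {i, j, k} ⊆
      (pts (W i ⊔ W j) ∪ (pts (W i ⊔ W k) \ pts (W i ⊔ W j))) ∪
        (pts (W j ⊔ W k) \ (pts (W i ⊔ W j) ∪ pts (W i ⊔ W k))) := by
    intro v hv
    have hv' : v ∈ W i ⊔ W j ∨ v ∈ W i ⊔ W k ∨ v ∈ W j ⊔ W k := by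
      obtain rfl | ⟨x, hx, y, hy, h⟩ := mem_pairCover.1 hv
      · exact Or.inl (zero_mem _)
      · simp only [Finset.mem_insert, Finset.mem_singleton] at hx hy
        rcases hx with rfl | rfl | rfl <;> rcases hy with rfl | rfl | rfl
        · exact Or.inl (SetLike.le_def.1 (sup_le le_sup_left le_sup_left) h)
        · exact Or.inl h
        · exact Or.inr (Or.inl h)
        · exact Or.inl (SetLike.le_def.1 (sup_le le_sup_right le_sup_left) h)
        · exact Or.inl (SetLike.le_def.1 (sup_le le_sup_right le_sup_right) h)
        · exact Or.inr (Or.inr h)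
        · exact Or.inr (Or.inl (SetLike.le_def.1 (sup_le le_sup_right le_sup_left) h))
        · exact Or.inr (Or.inr (SetLike.le_def.1 (sup_le le_sup_right le_sup_left) h))
        · exact Or.inr (Or.inl (SetLike.le_def.1 (sup_le le_sup_right le_sup_right) h))
    simp only [Finset.mem_union, Finset.mem_sdiff, mem_pts]
    tauto
  have c1 : (pts (W i ⊔ W j)).card = 16 := by
    rw [card_pts, h4 hij hi hj]
    norm_num
  -- The second span already has the plane of `W i` and `c` in common with the first: 16 - 8.
  have c2 : (pts (W i ⊔ W k) \ pts (W i ⊔ W j)).card ≤ 8 :=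
    card_pts_sdiff_le_of_le (A := W i ⊔ span (ZMod 2) {c}) (n := 4) (k := 3)
      (sup_le_sup_left ((span_singleton_le_iff_mem _ _).2 hc) _)
      (pts_mono (sup_le le_sup_left ((span_singleton_le_iff_mem _ _).2 hc')))
      (h4 hik hi hk).le (hsup hik hi hc hc0).ge
  -- The third span contains two covered planes, through `c` and through `b`, that meet in a line:
  -- 16 - 8 - 8 + 4.
  have c3 : (pts (W j ⊔ W k) \ (pts (W i ⊔ W j) ∪ pts (W i ⊔ W k))).card ≤ 4 := by
    have e : W j ⊔ W k = (W j ⊔ span (ZMod 2) {c}) ⊔ (W k ⊔ span (ZMod 2) {b}) := by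
      apply le_antisymm
      · exact sup_le (le_sup_left.trans le_sup_left) (le_sup_left.trans le_sup_right)
      · exact sup_le (sup_le_sup_left ((span_singleton_le_iff_mem _ _).2 hc) _)
          (sup_le le_sup_right (((span_singleton_le_iff_mem _ _).2 hb).trans le_sup_left))
    have h1 := card_pts_sdiff_le_of_sup (T := pts (W i ⊔ W j) ∪ pts (W i ⊔ W k)) e
      ((pts_mono (sup_le le_sup_right ((span_singleton_le_iff_mem _ _).2 hc'))).trans
        Finset.subset_union_left)
      ((pts_mono (sup_le le_sup_right ((span_singleton_le_iff_mem _ _).2 hb'))).trans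
        Finset.subset_union_right)
    have h2 := finrank_sup_add (W j ⊔ span (ZMod 2) {c}) (W k ⊔ span (ZMod 2) {b})
    have h3 := hsup hjk hj hc hc0
    have h5 := hsup (inf_comm (W j) (W k) ▸ hjk) hk hb hb0
    rw [← e, h4 hjk hj hk, h3, h5] at h2
    rw [h4 hjk hj hk, h3, h5, show finrank (ZMod 2) ((W j ⊔ span (ZMod 2) {c}) ⊓
      (W k ⊔ span (ZMod 2) {b}) : Submodule (ZMod 2) M) = 2 by omega] at h1
    omega
  have := Finset.card_le_card hcover
  have := Finset.card_union_le (pts (W i ⊔ W j) ∪ (pts (W i ⊔ W k) \ pts (W i ⊔ W j)))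
        (pts (W j ⊔ W k) \ (pts (W i ⊔ W j) ∪ pts (W i ⊔ W k)))
  have := Finset.card_union_le (pts (W i ⊔ W j)) (pts (W i ⊔ W k) \ pts (W i ⊔ W j))
  omega

omit [AddCommGroup M] [Module (ZMod 2) M] [Fintype M] in
theorem card_union_add_one_le {X Y : Finset M} {z : M} (hX : z ∈ X) (hY : z ∈ Y) :
    (X ∪ Y).card + 1 ≤ X.card + Y.card := by
  rw [← Finset.card_union_add_card_inter]
  have : 0 < (X ∩ Y).card := Finset.card_pos.2 ⟨z, Finset.mem_inter.2 ⟨hX, hY⟩⟩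
  omega

/-- Modulo `a` the line has only one nonzero class, and both `x` and `y` are in it. -/
theorem line_add_cases {A : Submodule (ZMod 2) M} (hA : finrank (ZMod 2) A = 2) {a x y : M}
    (ha : a ∈ A) (ha0 : a ≠ 0) (hx : x ∈ A) (hx0 : x ≠ 0) (hxa : x ≠ a) (hy : y ∈ A) (hy0 : y ≠ 0)
    (hya : y ≠ a) : x + y = 0 ∨ x + y = a := by
  have hxa' : x + a ≠ 0 := fun h => hxa (eq_of_add_eq_zero_of_two h)
  have h1 : ({0, a, x, x + a} : Finset M) = pts A := by
    apply Finset.eq_of_subset_of_card_le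
    · intro v hv
      simp only [Finset.mem_insert, Finset.mem_singleton] at hv
      rw [mem_pts]
      rcases hv with rfl | rfl | rfl | rfl
      · exact zero_mem _
      · exact ha
      · exact hx
      · exact add_mem hx ha
    · rw [card_pts, hA, Finset.card_insert_of_notMem, Finset.card_insert_of_notMem,
        Finset.card_pair]
      all_goals simp [ha0, hx0, hxa.symm, ha0.symm, hx0.symm, hxa'.symm]
  have h2 : y ∈ ({0, a, x, x + a} : Finset M) := by
    rw [h1, mem_pts]
    exact hy
  simp only [Finset.mem_insert, Finset.mem_singleton] at h2
  rcases h2 with rfl | rfl | rfl | rfl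
  · exact absurd rfl hy0
  · exact absurd rfl hya
  · exact Or.inl (add_self_of_two _)
  · exact Or.inr (add_add_cancel_of_two _ _)

/-- The union of the lines of a triple. -/
noncomputable def lineUnion (A : Fin 3 → Submodule (ZMod 2) M) : Finset M :=
  (pts (A 0) ∪ pts (A 1)) ∪ pts (A 2)

theorem mem_lineUnion {A : Fin 3 → Submodule (ZMod 2) M} {v : M} :
    v ∈ lineUnion A ↔ ∃ i, v ∈ A i := by
  simp [lineUnion, Fin.exists_fin_succ]

theorem zero_mem_lineUnion {A : Fin 3 → Submodule (ZMod 2) M} : (0 : M) ∈ lineUnion A :=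
  mem_lineUnion.2 ⟨0, zero_mem _⟩

theorem card_lineUnion_le {A : Fin 3 → Submodule (ZMod 2) M}
    (hA : ∀ i, finrank (ZMod 2) (A i) = 2) : (lineUnion A).card ≤ 10 := by
  have h0 : ∀ B : Submodule (ZMod 2) M, (0 : M) ∈ pts B := fun B => mem_pts.2 (zero_mem _)
  have h1 := card_union_add_one_le (h0 (A 0)) (h0 (A 1))
  have h2 := card_union_add_one_le (Finset.mem_union_left (pts (A 1)) (h0 (A 0))) (h0 (A 2))
  simp only [card_pts, hA] at h1 h2
  rw [lineUnion]
  omega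

/-- If every point lies on the span of two of six lines, a space of dimension at most five that
contains three of them is disjoint from the others. -/
theorem inf_eq_bot_of_cover (hM : finrank (ZMod 2) M = 7) {A B : Fin 3 → Submodule (ZMod 2) M}
    (hA : ∀ i, finrank (ZMod 2) (A i) = 2) (hB : ∀ i, finrank (ZMod 2) (B i) = 2)
    (hcov : ∀ v : M, (∃ i j, v ∈ A i ⊔ A j) ∨ (∃ i j, v ∈ A i ⊔ B j) ∨ ∃ i j, v ∈ B i ⊔ B j)
    {W : Submodule (ZMod 2) M} (hAW : ∀ i, A i ≤ W) (hW : finrank (ZMod 2) W ≤ 5) (k : Fin 3) :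
    B k ⊓ W = ⊥ := by
  by_contra hne
  have d1 := finrank_inf_pos_of_ne_bot hne
  have d2 := finrank_sup_add (B k) W
  rw [hB] at d2
  have hlt : B k ⊔ W < ⊤ := by
    rw [lt_top_iff_ne_top]
    intro h
    rw [h, finrank_top] at d2
    omega
  -- If `B k` met `W`, both would lie in a hyperplane `H`. Each of the 64 points outside `H` would
  -- then be the sum of a point outside `H` on one of the two remaining lines and a point of `H` on
  -- some line of the family.
  obtain ⟨f, hf0, hf⟩ := Submodule.exists_le_ker_of_lt_top _ hlt
  set H := LinearMap.ker f with hH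
  have hAH : ∀ i, A i ≤ H := fun i => (hAW i).trans (le_sup_right.trans hf)
  have hkH : B k ≤ H := le_sup_left.trans hf
  have hHrank : finrank (ZMod 2) H + 1 = 7 := by
    rw [← hM]
    exact Module.Dual.finrank_ker_add_one_of_ne_zero hf0
  have hsum : ∀ {x y : M}, x ∉ H → y ∉ H → x + y ∈ H := by
    intro x y hx hy
    rw [hH, LinearMap.mem_ker] at hx hy ⊢
    rw [map_add]
    generalize f x = p at *
    generalize f y = q at *
    revert p q
    decide
  have hout : (Finset.univ \ pts H).card = 64 := by
    rw [Finset.card_sdiff_of_subset (Finset.subset_univ _), card_pts,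
      show finrank (ZMod 2) H = 6 by omega, Finset.card_univ, ← Nat.card_eq_fintype_card,
      Module.natCard_eq_pow_finrank (K := ZMod 2), hM, Nat.card_zmod]
    norm_num
  have hk3 : ∀ k j : Fin 3, j = k ∨ j = k + 1 ∨ j = k + 2 := by decide
  have ho : ∀ j, (pts (B j) \ pts H).card ≤ 2 := by
    intro j
    have d3 := finrank_sup_add (B j) H
    have d4 := Submodule.finrank_le (B j ⊔ H)
    rw [hB] at d3
    exact card_pts_sdiff_le_of_le (A := B j ⊓ H) (n := 2) (k := 1) inf_le_left
      (pts_mono inf_le_right) (hB j).le (by omega)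
  have ho' : ∀ j, (pts (B j) ∩ pts H).card + (pts (B j) \ pts H).card = 4 := by
    intro j
    rw [Finset.card_inter_add_card_sdiff, card_pts, hB]
    norm_num
  let D := (pts (B (k + 1)) \ pts H) ∪ (pts (B (k + 2)) \ pts H)
  let S := ((lineUnion A ∪ pts (B k)) ∪ (pts (B (k + 1)) ∩ pts H)) ∪ (pts (B (k + 2)) ∩ pts H)
  have hDmem : ∀ {j x}, x ∈ B j → x ∉ H → x ∈ D := by
    intro j x hx hxH
    simp only [D, Finset.mem_union, Finset.mem_sdiff, mem_pts]
    obtain rfl | rfl | rfl := hk3 k j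
    · exact absurd (hkH hx) hxH
    · exact Or.inl ⟨hx, hxH⟩
    · exact Or.inr ⟨hx, hxH⟩
  have hSA : ∀ {j x}, x ∈ A j → x ∈ S := by
    intro j x hx
    simp only [S, Finset.mem_union]
    exact Or.inl (Or.inl (Or.inl (mem_lineUnion.2 ⟨j, hx⟩)))
  have hSB : ∀ {j x}, x ∈ B j → x ∈ H → x ∈ S := by
    intro j x hx hxH
    simp only [S, Finset.mem_union, Finset.mem_inter, mem_pts]
    obtain rfl | rfl | rfl := hk3 k j
    · exact Or.inl (Or.inl (Or.inr hx))
    · exact Or.inl (Or.inr ⟨hx, hxH⟩)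
    · exact Or.inr ⟨hx, hxH⟩
  have hsub : Finset.univ \ pts H ⊆ (D ×ˢ S).image fun q => q.1 + q.2 := by
    intro v hv
    simp only [Finset.mem_sdiff, Finset.mem_univ, true_and, mem_pts] at hv
    have key : ∀ {x y}, x ∈ D → y ∈ S → x + y = v →
        v ∈ (D ×ˢ S).image fun q => q.1 + q.2 := fun hx hy h =>
      Finset.mem_image.2 ⟨(_, _), Finset.mem_product.2 ⟨hx, hy⟩, h⟩
    obtain ⟨i, j, h⟩ | ⟨i, j, h⟩ | ⟨i, j, h⟩ := hcov v
    · exact absurd (sup_le (hAH i) (hAH j) h) hv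
    · obtain ⟨x, hx, y, hy, rfl⟩ := Submodule.mem_sup.1 h
      have hyH : y ∉ H := fun hyH => hv (add_mem (hAH i hx) hyH)
      exact key (hDmem hy hyH) (hSA hx) (add_comm _ _)
    · obtain ⟨x, hx, y, hy, rfl⟩ := Submodule.mem_sup.1 h
      by_cases hxH : x ∈ H
      · have hyH : y ∉ H := fun hyH => hv (add_mem hxH hyH)
        exact key (hDmem hy hyH) (hSB hx hxH) (add_comm _ _)
      · have hyH : y ∈ H := by
          by_contra hyH
          exact hv (hsum hxH hyH)
        exact key (hDmem hx hxH) (hSB hy hyH) rfl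
  have h0 : ∀ C : Submodule (ZMod 2) M, (0 : M) ∈ pts C := fun C => mem_pts.2 (zero_mem _)
  have h0' : ∀ j, (0 : M) ∈ pts (B j) ∩ pts H := fun j => Finset.mem_inter.2 ⟨h0 _, h0 _⟩
  have s1 := card_union_add_one_le (zero_mem_lineUnion (A := A)) (h0 (B k))
  have s2 := card_union_add_one_le
    (Finset.mem_union_left (pts (B k)) (zero_mem_lineUnion (A := A))) (h0' (k + 1))
  have s3 := card_union_add_one_le (Finset.mem_union_left (pts (B (k + 1)) ∩ pts H)
    (Finset.mem_union_left (pts (B k)) (zero_mem_lineUnion (A := A)))) (h0' (k + 2))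
  have s4 := card_lineUnion_le hA
  have s5 : D.card ≤ _ := Finset.card_union_le _ _
  rw [card_pts, hB] at s1
  have s6 := Finset.card_le_card hsub
  rw [hout] at s6
  have s7 := s6.trans Finset.card_image_le
  rw [Finset.card_product] at s7
  have t1 := ho (k + 1)
  have t2 := ho (k + 2)
  have t3 := ho' (k + 1)
  have t4 := ho' (k + 2)
  change S.card + 1 ≤ _ at s3
  generalize (pts (B (k + 1)) \ pts H).card = p at *
  generalize (pts (B (k + 2)) \ pts H).card = q at *
  -- Ten points on the lines `A`, then 3, `3 - p` and `3 - q` nonzero points of `H` on the lines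
  -- `B`.
  have s8 : S.card ≤ 19 - p - q := by omega
  have s9 := s7.trans (Nat.mul_le_mul s5 s8)
  -- With `n = p + q ≤ 4` there are at most `n (19 - n) ≤ 60` sums, fewer than 64.
  interval_cases p <;> interval_cases q <;> omega

end DependentTriple

section DependentTriple

variable {M : Type*} [AddCommGroup M] [Module (ZMod 2) M] [Fintype M] [DecidableEq M]

/-- Translation by `a r` preserves the line `A r` and permutes zero and the three dependent points;
only the two remaining points on each of the other two lines can leave the union. -/
theorem card_add_lineUnion_sdiff_le {A : Fin 3 → Submodule (ZMod 2) M}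
    (hA : ∀ i, finrank (ZMod 2) (A i) = 2) {a : Fin 3 → M} (ha : ∀ i, a i ∈ A i)
    (ha0 : ∀ i, a i ≠ 0) (hsum : ∀ r, a r + a (r + 1) = a (r + 2) ∧ a r + a (r + 2) = a (r + 1))
    (r : Fin 3) : ((lineUnion A).image (fun x => a r + x) \ lineUnion A).card ≤ 4 := by
  have hr3 : ∀ r j : Fin 3, j = r ∨ j = r + 1 ∨ j = r + 2 := by decide
  have hc : ∀ i, (pts (A i) \ {0, a i}).card = 2 := by
    intro i
    rw [Finset.card_sdiff_of_subset, card_pts, hA, Finset.card_pair (ha0 i).symm]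
    · norm_num
    · intro v hv
      simp only [Finset.mem_insert, Finset.mem_singleton] at hv
      rw [mem_pts]
      obtain rfl | rfl := hv
      · exact zero_mem _
      · exact ha i
  have hsub : (lineUnion A).image (fun x => a r + x) \ lineUnion A ⊆
      ((pts (A (r + 1)) \ {0, a (r + 1)}) ∪ (pts (A (r + 2)) \ {0, a (r + 2)})).image
        (fun x => a r + x) := by
    intro v hv
    obtain ⟨hv1, hv2⟩ := Finset.mem_sdiff.1 hv
    obtain ⟨x, hx, rfl⟩ := Finset.mem_image.1 hv1
    refine Finset.mem_image_of_mem _ ?_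
    obtain ⟨j, hj⟩ := mem_lineUnion.1 hx
    have hx0 : x ≠ 0 := by
      rintro rfl
      rw [add_zero] at hv2
      exact hv2 (mem_lineUnion.2 ⟨r, ha r⟩)
    simp only [Finset.mem_union, Finset.mem_sdiff, mem_pts, Finset.mem_insert,
      Finset.mem_singleton, not_or]
    obtain rfl | rfl | rfl := hr3 r j
    · exact absurd (mem_lineUnion.2 ⟨j, add_mem (ha j) hj⟩) hv2
    · refine Or.inl ⟨hj, hx0, ?_⟩
      rintro rfl
      rw [(hsum r).1] at hv2
      exact hv2 (mem_lineUnion.2 ⟨_, ha _⟩)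
    · refine Or.inr ⟨hj, hx0, ?_⟩
      rintro rfl
      rw [(hsum r).2] at hv2
      exact hv2 (mem_lineUnion.2 ⟨_, ha _⟩)
  refine (Finset.card_le_card hsub).trans (Finset.card_image_le.trans ?_)
  refine (Finset.card_union_le _ _).trans ?_
  rw [hc, hc]

/-- In a cover by six lines, three of them dependent, no point of the dependency is the sum of
points on two of the other lines. -/
theorem add_ne_of_cover (hM : finrank (ZMod 2) M = 7) {A B : Fin 3 → Submodule (ZMod 2) M}
    (hA : ∀ i, finrank (ZMod 2) (A i) = 2) (hB : ∀ i, finrank (ZMod 2) (B i) = 2)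
    (hcov : ∀ v : M, (∃ i j, v ∈ A i ⊔ A j) ∨ (∃ i j, v ∈ A i ⊔ B j) ∨ ∃ i j, v ∈ B i ⊔ B j)
    {a : Fin 3 → M} (ha : ∀ i, a i ∈ A i)
    (ha0 : ∀ i, a i ≠ 0) (hsum : ∀ r, a r + a (r + 1) = a (r + 2) ∧ a r + a (r + 2) = a (r + 1))
    {W : Submodule (ZMod 2) M} (hAW : ∀ i, A i ≤ W) (hW : finrank (ZMod 2) W = 5)
    {c : Fin 3 → M → M} (hcB : ∀ i v, c i v ∈ B i) (hcW : ∀ i v, c i v - v ∈ W)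
    (hcu : ∀ i v w, w ∈ B i → w - v ∈ W → w = c i v)
    {i j : Fin 3} (hij : i ≠ j) {x y : M} (hx : x ∈ B i) (hy : y ∈ B j) (hx0 : x ≠ 0)
    (r : Fin 3) : x + y ≠ a r := by
  intro hxy
  have hBW := inf_eq_bot_of_cover hM hA hB hcov hAW hW.le
  have hxW : x ∉ W := by
    intro h
    have : x ∈ B i ⊓ W := ⟨hx, h⟩
    rw [hBW, mem_bot] at this
    exact hx0 this
  have hyx : y = x + a r := by rw [← hxy, add_add_cancel_of_two]
  -- `c k` picks the only point of `B k` in a given coset of `W`. As `x + y` is in `W`, both `x` and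
  -- `y` represent the coset of `x`.
  have hci : c i x = x := (hcu i x x hx (by rw [sub_self]; exact zero_mem _)).symm
  have hcj : c j x = y := (hcu j x y hy (by
    rw [hyx, add_sub_cancel_left]
    exact hAW r (ha r))).symm
  set S := lineUnion A with hS
  -- A covered point of the coset of `x` is either the representative on some `B k` plus a point of
  -- the lines `A` (`T`), or a sum over two lines `B` (`R`). Sums with `b = 0` or `b = c q.1 x`
  -- already lie in `T`, leaving two choices of `b` per pair.
  let T : Fin 3 → Finset M := fun k => S.image fun s => c k x + s
  let R : Fin 3 × Fin 3 → Finset M := fun q =>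
    (pts (B q.1) \ {0, c q.1 x}).image fun b => b + c q.2 (x - b)
  have hT : ∀ k, (T k).card ≤ 10 := fun k => Finset.card_image_le.trans (card_lineUnion_le hA)
  have hTmem : ∀ k s, s ∈ S → c k x + s ∈ T k := fun k s hs => Finset.mem_image_of_mem _ hs
  have hck : ∀ k, c k x ≠ 0 := by
    intro k h
    have := hcW k x
    rw [h, zero_sub] at this
    exact hxW (neg_mem_iff.1 this)
  have hR : ∀ q, (R q).card ≤ 2 := by
    intro q
    refine Finset.card_image_le.trans ?_
    rw [Finset.card_sdiff_of_subset, card_pts, hB, Finset.card_pair (hck _).symm]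
    · norm_num
    · intro v hv
      simp only [Finset.mem_insert, Finset.mem_singleton] at hv
      rw [mem_pts]
      obtain rfl | rfl := hv
      · exact zero_mem _
      · exact hcB _ _
  let Q : Finset (Fin 3 × Fin 3) := {(0, 1), (0, 2), (1, 2)}
  have hQ : ∀ k l : Fin 3, k ≠ l → (k, l) ∈ Q ∨ (l, k) ∈ Q := by decide
  obtain ⟨t, ht⟩ : ∃ t, ∀ k, k = i ∨ k = j ∨ k = t := by
    have : ∀ i j : Fin 3, i ≠ j → ∃ t, ∀ k, k = i ∨ k = j ∨ k = t := by decide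
    exact this i j hij
  have hTij : ∀ k, T k ⊆ (T i ∪ (T j \ T i)) ∪ T t := by
    intro k v hv
    simp only [Finset.mem_union, Finset.mem_sdiff]
    obtain rfl | rfl | rfl := ht k
    · exact Or.inl (Or.inl hv)
    · by_cases h : v ∈ T i
      · exact Or.inl (Or.inl h)
      · exact Or.inl (Or.inr ⟨hv, h⟩)
    · exact Or.inr hv
  have hpair : ∀ k l, (k, l) ∈ Q → ∀ b ∈ B k, ∀ b' ∈ B l, b + b' - x ∈ W →
      (∃ m, b + b' ∈ T m) ∨ b + b' ∈ Q.biUnion R := by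
    intro k l hkl b hb b' hb' h
    have hb'c : b' = c l (x - b) := hcu l _ _ hb' (by
      rw [show b' - (x - b) = b + b' - x by abel]
      exact h)
    by_cases hb0 : b = 0
    · left
      rw [hb0, sub_zero] at hb'c
      rw [hb0, zero_add, hb'c]
      refine ⟨l, ?_⟩
      have := hTmem l 0 zero_mem_lineUnion
      rwa [add_zero] at this
    by_cases hbc : b = c k x
    · left
      refine ⟨k, ?_⟩
      have : b' = 0 := by
        have hW' : b' ∈ B l ⊓ W := by
          refine ⟨hb', ?_⟩
          have h1 : b - x ∈ W := by
            rw [hbc]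
            exact hcW k x
          have h2 := sub_mem h h1
          rwa [show b + b' - x - (b - x) = b' by abel] at h2
        rwa [hBW, mem_bot] at hW'
      rw [this, hbc]
      exact hTmem k 0 zero_mem_lineUnion
    · right
      refine Finset.mem_biUnion.2 ⟨(k, l), hkl, ?_⟩
      rw [hb'c]
      exact Finset.mem_image_of_mem (fun b => b + c l (x - b)) (by simp [hb, hb0, hbc])
  have hfib : (pts W).image (fun w => x + w) ⊆ ((T i ∪ (T j \ T i)) ∪ T t) ∪ Q.biUnion R := by
    intro v hv
    obtain ⟨w, hw, rfl⟩ := Finset.mem_image.1 hv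
    rw [mem_pts] at hw
    have hvW : x + w - x ∈ W := by rwa [add_sub_cancel_left]
    generalize x + w = v at hvW
    rw [Finset.mem_union]
    have fin1 : (∃ m, v ∈ T m) ∨ v ∈ Q.biUnion R →
        v ∈ (T i ∪ (T j \ T i)) ∪ T t ∨ v ∈ Q.biUnion R := by
      rintro (⟨m, hm⟩ | h)
      · exact Or.inl (hTij m hm)
      · exact Or.inr h
    apply fin1
    obtain ⟨k, l, h⟩ | ⟨k, l, h⟩ | ⟨k, l, h⟩ := hcov v
    · have hv : v ∈ W := sup_le (hAW k) (hAW l) h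
      have h1 := sub_mem hv hvW
      rw [sub_sub_cancel] at h1
      exact absurd h1 hxW
    · obtain ⟨p, hp, b, hb, rfl⟩ := Submodule.mem_sup.1 h
      left
      refine ⟨l, ?_⟩
      have hbc : b = c l x := hcu l x b hb (by
        have h1 := sub_mem hvW (hAW k hp)
        rwa [show p + b - x - p = b - x by abel] at h1)
      rw [hbc, add_comm]
      exact hTmem l p (mem_lineUnion.2 ⟨k, hp⟩)
    · by_cases hkl : k = l
      · left
        subst hkl
        rw [sup_idem] at h
        refine ⟨k, ?_⟩
        have := hTmem k 0 zero_mem_lineUnion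
        rwa [add_zero, ← hcu k x v h hvW] at this
      · obtain ⟨b, hb, b', hb', rfl⟩ := Submodule.mem_sup.1 h
        obtain h1 | h1 := hQ k l hkl
        · exact hpair k l h1 b hb b' hb' hvW
        · rw [add_comm] at hvW ⊢
          exact hpair l k h1 b' hb' b hb hvW
  -- `T j` is `T i` translated by `a r`, which is where the assumed relation `x + y = a r` costs
  -- points.
  have hTsd : (T j \ T i).card ≤ 4 := by
    refine le_trans ?_ (card_add_lineUnion_sdiff_le hA ha ha0 hsum r)
    refine le_trans (Finset.card_le_card ?_) (Finset.card_image_le (f := fun s => x + s))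
    intro v hv
    obtain ⟨hv1, hv2⟩ := Finset.mem_sdiff.1 hv
    obtain ⟨s, hs, rfl⟩ := Finset.mem_image.1 hv1
    refine Finset.mem_image.2 ⟨a r + s, Finset.mem_sdiff.2 ⟨Finset.mem_image_of_mem _ hs, ?_⟩, ?_⟩
    · intro h
      apply hv2
      have := hTmem i _ h
      rwa [hci, ← add_assoc, ← hyx, ← hcj] at this
    · rw [hcj, hyx, add_assoc]
  have e1 := Finset.card_le_card hfib
  rw [Finset.card_image_of_injective _ (add_right_injective x), card_pts, hW] at e1
  have e2 := Finset.card_union_le ((T i ∪ (T j \ T i)) ∪ T t) (Q.biUnion R)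
  have e3 := Finset.card_union_le (T i ∪ (T j \ T i)) (T t)
  have e4 := Finset.card_union_le (T i) (T j \ T i)
  have e5 : (Q.biUnion R).card ≤ 3 * 2 := Finset.card_biUnion_le_card_mul Q R 2 fun q _ => hR q
  have e6 := hT i
  have e7 := hT t
  -- The coset has 32 points, but at most 10 + 4 + 10 + 6 = 30 are covered.
  omega

/-- Six pairwise disjoint lines, three of them dependent, in dimension seven: some point is on no
span of two of them. -/
theorem not_cover_of_dependent (hM : finrank (ZMod 2) M = 7)
    {A B : Fin 3 → Submodule (ZMod 2) M}
    (hA : ∀ i, finrank (ZMod 2) (A i) = 2) (hB : ∀ i, finrank (ZMod 2) (B i) = 2)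
    (hAA : ∀ i j, i ≠ j → A i ⊓ A j = ⊥) (hBB : ∀ i j, i ≠ j → B i ⊓ B j = ⊥)
    {a : Fin 3 → M} (ha : ∀ i, a i ∈ A i) (ha0 : ∀ i, a i ≠ 0) (hsum : a 0 + a 1 + a 2 = 0) :
    ¬ ∀ v : M, (∃ i j, v ∈ A i ⊔ A j) ∨ (∃ i j, v ∈ A i ⊔ B j) ∨ ∃ i j, v ∈ B i ⊔ B j := by
  intro hcov
  have h012 : a 2 = a 0 + a 1 := (eq_of_add_eq_zero_of_two hsum).symm
  have hsum' : ∀ r, a r + a (r + 1) = a (r + 2) ∧ a r + a (r + 2) = a (r + 1) := by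
    have h1 : a 0 + a 2 = a 1 := by rw [h012, add_add_cancel_of_two]
    have h2 : a 1 + a 2 = a 0 := by rw [h012, add_comm (a 0), add_add_cancel_of_two]
    intro r
    fin_cases r
    · exact ⟨h012.symm, h1⟩
    · exact ⟨h2, (add_comm _ _).trans h012.symm⟩
    · exact ⟨(add_comm _ _).trans h1, (add_comm _ _).trans h2⟩
  set V := A 0 ⊔ A 1 ⊔ A 2 with hV
  have hAV : ∀ i, A i ≤ V := by
    intro i
    fin_cases i
    · exact le_sup_left.trans le_sup_left
    · exact le_sup_right.trans le_sup_left
    · exact le_sup_right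
  have hV5 : finrank (ZMod 2) V ≤ 5 := by
    have h1 := finrank_sup_add (A 0) (A 1)
    have h2 := finrank_sup_add (A 0 ⊔ A 1) (A 2)
    have h3 : (A 0 ⊔ A 1) ⊓ A 2 ≠ ⊥ := by
      intro h
      have : a 2 ∈ (A 0 ⊔ A 1) ⊓ A 2 :=
        ⟨h012 ▸ add_mem (mem_sup_left (ha 0)) (mem_sup_right (ha 1)), ha 2⟩
      rw [h, mem_bot] at this
      exact ha0 2 this
    have h4 := finrank_inf_pos_of_ne_bot h3
    rw [hA, hA] at h1
    rw [hA, ← hV] at h2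
    omega
  -- Dimension exactly five makes each `B i`, being disjoint from `W`, a complement of it.
  obtain ⟨W, hVW, hW⟩ := exists_le_finrank_eq (n := 5) hV5 (by omega)
  have hAW : ∀ i, A i ≤ W := fun i => (hAV i).trans hVW
  have hBW := inf_eq_bot_of_cover hM hA hB hcov hAW hW.le
  have hBW' : ∀ i, B i ⊔ W = ⊤ := by
    intro i
    apply Submodule.eq_top_of_finrank_eq
    have := finrank_sup_add (B i) W
    rw [hBW, finrank_bot, hB, hW] at this
    omega
  have hex : ∀ i v, ∃ w, w ∈ B i ∧ w - v ∈ W := by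
    intro i v
    have hv : v ∈ B i ⊔ W := hBW' i ▸ mem_top
    obtain ⟨b, hb, w, hw, rfl⟩ := Submodule.mem_sup.1 hv
    refine ⟨b, hb, ?_⟩
    rw [sub_add_cancel_left]
    exact neg_mem hw
  choose c hcB hcW using hex
  have hcu : ∀ i v w, w ∈ B i → w - v ∈ W → w = c i v := by
    intro i v w hw hwv
    have h1 : w - c i v ∈ B i ⊓ W := by
      refine ⟨sub_mem hw (hcB i v), ?_⟩
      rw [← sub_sub_sub_cancel_right w (c i v) v]
      exact sub_mem hwv (hcW i v)
    rw [hBW, mem_bot, sub_eq_zero] at h1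
    exact h1
  have hne := fun {i j : Fin 3} (hij : i ≠ j) {x y : M} (hx : x ∈ B i) (hy : y ∈ B j)
    (hx0 : x ≠ 0) r => add_ne_of_cover hM hA hB hcov ha ha0 hsum' hAW hW hcB hcW hcu hij hx hy hx0 r
  let C := pairCover A Finset.univ
  let N := pts W \ C
  have hCmem : ∀ {i j v}, v ∈ A i ⊔ A j → v ∈ C := fun h =>
    pts_sup_subset_pairCover (Finset.mem_univ _) (Finset.mem_univ _) (mem_pts.2 h)
  -- A point of `N` must come from two lines `B`; its component `b` on one determines the component
  -- on the other, so each pair gives at most three.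
  let G : Fin 3 × Fin 3 → Finset M := fun q =>
    (pts (B q.1) \ {0}).image fun b => b + c q.2 (-b)
  let Q : Finset (Fin 3 × Fin 3) := {(0, 1), (0, 2), (1, 2)}
  have hQ : ∀ k l : Fin 3, k ≠ l → (k, l) ∈ Q ∨ (l, k) ∈ Q := by decide
  have hQne : ∀ q ∈ Q, q.1 ≠ q.2 := by decide
  have hG : ∀ q, (G q).card ≤ 3 := by
    intro q
    refine Finset.card_image_le.trans ?_
    rw [Finset.card_sdiff_of_subset, card_pts, hB, Finset.card_singleton]
    · norm_num
    rw [Finset.singleton_subset_iff, mem_pts]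
    exact zero_mem _
  have hpair : ∀ k l, (k, l) ∈ Q → ∀ b ∈ B k, ∀ b' ∈ B l, b + b' ∈ W → b + b' ≠ 0 →
      b + b' ∈ G (k, l) := by
    intro k l _ b hb b' hb' h h0
    have hb'c : b' = c l (-b) := hcu l _ _ hb' (by rwa [sub_neg_eq_add, add_comm])
    have hb0 : b ≠ 0 := by
      rintro rfl
      have : b' ∈ B l ⊓ W := ⟨hb', by rwa [zero_add] at h⟩
      rw [hBW, mem_bot] at this
      exact h0 (by rw [this, add_zero])
    rw [hb'c]
    exact Finset.mem_image_of_mem (fun b => b + c l (-b)) (by simp [hb, hb0])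
  have hNG : N ⊆ Q.biUnion fun q => N ∩ G q := by
    intro v hv
    obtain ⟨hvW, hvC⟩ := Finset.mem_sdiff.1 hv
    rw [mem_pts] at hvW
    have hv0 : v ≠ 0 := by
      rintro rfl
      exact hvC zero_mem_pairCover
    have fin1 : (∃ q ∈ Q, v ∈ G q) → v ∈ Q.biUnion fun q => N ∩ G q := by
      rintro ⟨q, hq, h⟩
      exact Finset.mem_biUnion.2 ⟨q, hq, Finset.mem_inter.2 ⟨hv, h⟩⟩
    apply fin1
    obtain ⟨k, l, h⟩ | ⟨k, l, h⟩ | ⟨k, l, h⟩ := hcov v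
    · exact absurd (hCmem h) hvC
    · obtain ⟨p, hp, b, hb, rfl⟩ := Submodule.mem_sup.1 h
      have hb0 : b ∈ B l ⊓ W := ⟨hb, (add_mem_cancel_left (hAW k hp)).1 hvW⟩
      rw [hBW, mem_bot] at hb0
      rw [hb0, add_zero] at hvC
      exact absurd (hCmem (i := k) (j := k) (mem_sup_left hp)) hvC
    · by_cases hkl : k = l
      · subst hkl
        rw [sup_idem] at h
        have : v ∈ B k ⊓ W := ⟨h, hvW⟩
        rw [hBW, mem_bot] at this
        exact absurd this hv0
      · obtain ⟨b, hb, b', hb', rfl⟩ := Submodule.mem_sup.1 h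
        obtain h1 | h1 := hQ k l hkl
        · exact ⟨_, h1, hpair k l h1 b hb b' hb' hvW hv0⟩
        · rw [add_comm] at hvW hv0 ⊢
          exact ⟨_, h1, hpair l k h1 b' hb' b hb hvW hv0⟩
  have hN9 : N.card ≤ 9 := by
    refine (Finset.card_le_card hNG).trans ?_
    exact Finset.card_biUnion_le_card_mul Q _ 3 fun q _ =>
      (Finset.card_le_card Finset.inter_subset_right).trans (hG q)
  have hCV : C ⊆ pts V := by
    intro v hv
    rw [mem_pts]
    obtain rfl | ⟨i, -, j, -, h⟩ := mem_pairCover.1 hv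
    · exact zero_mem _
    · exact sup_le (hAV i) (hAV j) h
  -- If `V` were smaller, at least 16 points of `W` would be outside `V`, more than the nine
  -- available.
  have hVeq : V = W := by
    apply Submodule.eq_of_le_of_finrank_le hVW
    by_contra hlt
    have h1 : (pts W \ pts V).card ≤ N.card := Finset.card_le_card
      (Finset.sdiff_subset_sdiff le_rfl hCV)
    rw [Finset.card_sdiff_of_subset (pts_mono hVW), card_pts, card_pts, hW] at h1
    have h2 : 2 ^ finrank (ZMod 2) V ≤ 2 ^ 4 := Nat.pow_le_pow_right (by norm_num) (by omega)
    omega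
  have hC28 : C.card ≤ 28 := by
    have := card_pairCover_dependent_le (W := A) (hA 0) (hA 1) (hA 2) (hAA 0 1 (by decide))
      (hAA 0 2 (by decide)) (hAA 1 2 (by decide)) (ha 0) (ha 1) (ha 2) (ha0 1) (ha0 2) hsum
    exact this
  have hN4 : 4 ≤ N.card := by
    have := Finset.card_sdiff_add_card_eq_card (hVeq ▸ hCV : C ⊆ pts W)
    rw [card_pts, hW] at this
    change N.card + C.card = 2 ^ 5 at this
    omega
  -- A component equal to zero or to a dependent point can be removed, a dependent point being the
  -- sum of the other two; the point would then be on a pair span of the triple.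
  have hform : ∀ v ∈ N, ∃ x y z, v = x + y + z ∧ (x ∈ A 0 ∧ x ≠ 0 ∧ x ≠ a 0) ∧
      (y ∈ A 1 ∧ y ≠ 0 ∧ y ≠ a 1) ∧ (z ∈ A 2 ∧ z ≠ 0 ∧ z ≠ a 2) := by
    intro v hv
    obtain ⟨hvW, hvC⟩ := Finset.mem_sdiff.1 hv
    rw [mem_pts, ← hVeq] at hvW
    obtain ⟨s, hs, z, hz, rfl⟩ := Submodule.mem_sup.1 hvW
    obtain ⟨x, hx, y, hy, rfl⟩ := Submodule.mem_sup.1 hs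
    have key : ∀ {i j : Fin 3} {p q : M}, p ∈ A i → q ∈ A j → x + y + z ≠ p + q := by
      intro i j p q hp hq h
      apply hvC
      rw [h]
      exact hCmem (add_mem (mem_sup_left hp) (mem_sup_right hq))
    have e0 := (hsum' 0).1
    have e1 := (hsum' 1).1
    have e2 := (hsum' 2).1
    simp only [Fin.isValue, show (0 : Fin 3) + 1 = 1 from rfl, show (0 : Fin 3) + 2 = 2 from rfl,
      show (1 : Fin 3) + 1 = 2 from rfl, show (1 : Fin 3) + 2 = 0 from rfl,
      show (2 : Fin 3) + 1 = 0 from rfl, show (2 : Fin 3) + 2 = 1 from rfl] at e0 e1 e2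
    refine ⟨x, y, z, rfl, ⟨hx, ?_, ?_⟩, ⟨hy, ?_, ?_⟩, ⟨hz, ?_, ?_⟩⟩
    · rintro rfl
      exact key hy hz (by abel)
    · rintro rfl
      exact key (add_mem (ha 1) hy) (add_mem (ha 2) hz) (by rw [← e1]; abel)
    · rintro rfl
      exact key hx hz (by abel)
    · rintro rfl
      exact key (add_mem (ha 0) hx) (add_mem (ha 2) hz) (by rw [← e2]; abel)
    · rintro rfl
      exact key hx hy (by abel)
    · rintro rfl
      exact key (add_mem (ha 0) hx) (add_mem (ha 1) hy) (by rw [← e0]; abel)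
  have hdiff : ∀ v ∈ N, ∀ w ∈ N, v + w = 0 ∨ ∃ r, v + w = a r := by
    intro v hv w hw
    obtain ⟨x, y, z, rfl, ⟨hx, hx0, hxa⟩, ⟨hy, hy0, hya⟩, ⟨hz, hz0, hza⟩⟩ := hform v hv
    obtain ⟨x', y', z', rfl, ⟨hx', hx0', hxa'⟩, ⟨hy', hy0', hya'⟩, ⟨hz', hz0', hza'⟩⟩ := hform w hw
    have e : x + y + z + (x' + y' + z') = (x + x') + (y + y') + (z + z') := by abel
    have e0 := (hsum' 0).2
    have e1 := (hsum' 1).1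
    simp only [Fin.isValue, show (0 : Fin 3) + 1 = 1 from rfl, show (0 : Fin 3) + 2 = 2 from rfl,
      show (1 : Fin 3) + 1 = 2 from rfl, show (1 : Fin 3) + 2 = 0 from rfl] at e0 e1
    rw [e]
    obtain h1 | h1 := line_add_cases (hA 0) (ha 0) (ha0 0) hx hx0 hxa hx' hx0' hxa' <;>
    obtain h2 | h2 := line_add_cases (hA 1) (ha 1) (ha0 1) hy hy0 hya hy' hy0' hya' <;>
    obtain h3 | h3 := line_add_cases (hA 2) (ha 2) (ha0 2) hz hz0 hza hz' hz0' hza' <;>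
    rw [h1, h2, h3]
    · exact Or.inl (by simp)
    · exact Or.inr ⟨2, by simp⟩
    · exact Or.inr ⟨1, by simp⟩
    · exact Or.inr ⟨0, by simp [e1]⟩
    · exact Or.inr ⟨0, by simp⟩
    · exact Or.inr ⟨1, by simp [e0]⟩
    · exact Or.inr ⟨2, by simp [h012]⟩
    · exact Or.inl hsum
  -- Two distinct points of `N` from one pair would have a dependent point as their sum, written
  -- over two lines `B`; `add_ne_of_cover` excludes this. So `N` has at most three points, against
  -- at least four.
  have hN1 : ∀ q ∈ Q, (N ∩ G q).card ≤ 1 := by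
    intro q hq
    rw [Finset.card_le_one]
    intro v hv w hw
    obtain ⟨hvN, hvG⟩ := Finset.mem_inter.1 hv
    obtain ⟨hwN, hwG⟩ := Finset.mem_inter.1 hw
    obtain ⟨b, hb, rfl⟩ := Finset.mem_image.1 hvG
    obtain ⟨d, hd, rfl⟩ := Finset.mem_image.1 hwG
    rw [Finset.mem_sdiff, mem_pts] at hb hd
    have hbd : b + d ∈ B q.1 := add_mem hb.1 hd.1
    have hcc : c q.2 (-b) + c q.2 (-d) ∈ B q.2 := add_mem (hcB _ _) (hcB _ _)
    have e : b + c q.2 (-b) + (d + c q.2 (-d)) = (b + d) + (c q.2 (-b) + c q.2 (-d)) := by abel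
    by_cases h0 : b + d = 0
    · rw [eq_of_add_eq_zero_of_two h0]
    · obtain h | ⟨r, h⟩ := hdiff _ hvN _ hwN
      · rw [e] at h
        have h1 : b + d ∈ B q.1 ⊓ B q.2 := ⟨hbd, eq_of_add_eq_zero_of_two h ▸ hcc⟩
        rw [hBB _ _ (hQne q hq), mem_bot] at h1
        exact absurd h1 h0
      · rw [e] at h
        exact absurd h (hne (hQne q hq) hbd hcc h0 r)
  have := (Finset.card_le_card hNG).trans (Finset.card_biUnion_le_card_mul Q _ 1 hN1)
  have hQc : Q.card = 3 := rfl
  omega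

end DependentTriple

/-! ### Bounds for five and six lines in dimension seven. -/

section LineFamilies

variable {M : Type*} [AddCommGroup M] [Module (ZMod 2) M] [Fintype M] [DecidableEq M]
  {ι : Type*} [DecidableEq ι] {W : ι → Submodule (ZMod 2) M} {K : Finset ι}

omit [Fintype M] [DecidableEq M] [DecidableEq ι] in
theorem exists_dependency {i j k : ι} (hik : W i ⊓ W k = ⊥) (hjk : W j ⊓ W k = ⊥)
    (h : W k ⊓ (W i ⊔ W j) ≠ ⊥) : ∃ a b c, a ∈ W i ∧ b ∈ W j ∧ c ∈ W k ∧ a ≠ 0 ∧ b ≠ 0 ∧ c ≠ 0 ∧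
      a + b + c = 0 := by
  obtain ⟨c, ⟨hc, hc'⟩, hc0⟩ := Submodule.exists_mem_ne_zero_of_ne_bot h
  obtain ⟨a, ha, b, hb, rfl⟩ := Submodule.mem_sup.1 hc'
  refine ⟨a, b, a + b, ha, hb, hc, ?_, ?_, hc0, add_self_of_two _⟩
  · rintro rfl
    rw [zero_add] at hc hc0
    have : b ∈ W j ⊓ W k := ⟨hb, hc⟩
    rw [hjk, mem_bot] at this
    exact hc0 this
  · rintro rfl
    rw [add_zero] at hc hc0
    have : a ∈ W i ⊓ W k := ⟨ha, hc⟩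
    rw [hik, mem_bot] at this
    exact hc0 this

theorem card_pairCover_le_of_card_five (hM : finrank (ZMod 2) M = 7) (hcard : K.card = 5)
    (hK : ∀ i ∈ K, finrank (ZMod 2) (W i) = 2) : (pairCover W K).card ≤ 97 := by
  by_cases h2 : ∀ i ∈ K, ∀ j ∈ K, i ≠ j → W i ⊓ W j = ⊥
  · by_cases h3 : ∀ i ∈ K, ∀ j ∈ K, ∀ k ∈ K, i ≠ j → k ≠ i → k ≠ j → W k ⊓ (W i ⊔ W j) = ⊥
    · have e1 := three_mul_card_biUnion_properPts_le hM (by omega) hK h3 h2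
      have e2 := card_pairCover_le_properPts hK
      rw [hcard] at e1 e2
      norm_num [Nat.choose] at e1 e2
      omega
    · push Not at h3
      obtain ⟨i, hi, j, hj, k, hk, hij, hki, hkj, h⟩ := h3
      have hik := h2 i hi k hk hki.symm
      have hjk := h2 j hj k hk hkj.symm
      obtain ⟨a, b, c, ha, hb, hc, ha0, hb0, hc0, habc⟩ := exists_dependency hik hjk h
      have e1 := card_pairCover_dependent_le (hK i hi) (hK j hj) (hK k hk) (h2 i hi j hj hij)
        hik hjk ha hb hc hb0 hc0 habc
      have hsub : ({i, j, k} : Finset ι) ⊆ K := by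
        simp [Finset.insert_subset_iff, hi, hj, hk]
      have hc3 : ({i, j, k} : Finset ι).card = 3 := by
        rw [Finset.card_eq_three]
        exact ⟨i, j, k, hij, hki.symm, hkj.symm, rfl⟩
      have hrest : (K \ {i, j, k}).card = 2 := by
        rw [Finset.card_sdiff_of_subset hsub, hcard, hc3]
      obtain ⟨l, m, hlm, hlm'⟩ := Finset.card_eq_two.1 hrest
      have hKeq : K = insert m (insert l {i, j, k}) := by
        rw [← Finset.sdiff_union_of_subset hsub, hlm']
        ext x
        simp only [Finset.mem_union, Finset.mem_insert, Finset.mem_singleton]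
        tauto
      have hl : l ∈ K \ {i, j, k} := by simp [hlm']
      have hm : m ∈ K \ {i, j, k} := by simp [hlm']
      rw [Finset.mem_sdiff] at hl hm
      have e2 := card_pairCover_insert_le (W := W) (K := {i, j, k}) (k := l)
        (fun x hx => hK x (hsub hx)) (hK l hl.1)
      have e3 := card_pairCover_insert_le (W := W) (K := insert l {i, j, k}) (k := m)
        (fun x hx => hK x (Finset.insert_subset hl.1 hsub hx)) (hK m hm.1)
      rw [Finset.card_insert_of_notMem hl.2, hc3] at e3
      rw [hc3] at e2
      rw [hKeq]
      omega
  · push Not at h2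
    obtain ⟨i, hi, j, hj, hij, h⟩ := h2
    have e1 := card_pairCover_le_of_meeting hK hi hj hij h
    have e2 := card_pairCover_le (K := K.erase i) (W := W)
      fun l hl => hK l (Finset.mem_of_mem_erase hl)
    rw [Finset.card_erase_of_mem hi, hcard] at e2
    rw [hcard] at e1
    norm_num [Nat.choose] at e1 e2
    omega

/-- In dimension seven, the spans of the pairs of six lines do not cover all points. -/
theorem card_pairCover_lt_of_card_six (hM : finrank (ZMod 2) M = 7) (hcard : K.card = 6)
    (hK : ∀ i ∈ K, finrank (ZMod 2) (W i) = 2) : (pairCover W K).card < 128 := by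
  by_cases h2 : ∀ i ∈ K, ∀ j ∈ K, i ≠ j → W i ⊓ W j = ⊥
  · by_cases h3 : ∀ i ∈ K, ∀ j ∈ K, ∀ k ∈ K, i ≠ j → k ≠ i → k ≠ j → W k ⊓ (W i ⊔ W j) = ⊥
    · have e1 := three_mul_card_biUnion_properPts_le hM (by omega) hK h3 h2
      have e2 := card_pairCover_le_properPts hK
      rw [hcard] at e1 e2
      norm_num [Nat.choose] at e1 e2
      omega
    · push Not at h3
      obtain ⟨i, hi, j, hj, k, hk, hij, hki, hkj, h⟩ := h3
      have hik := h2 i hi k hk hki.symm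
      have hjk := h2 j hj k hk hkj.symm
      obtain ⟨a, b, c, ha, hb, hc, ha0, hb0, hc0, habc⟩ := exists_dependency hik hjk h
      have hsub : ({i, j, k} : Finset ι) ⊆ K := by
        simp [Finset.insert_subset_iff, hi, hj, hk]
      have hc3 : ({i, j, k} : Finset ι).card = 3 := by
        rw [Finset.card_eq_three]
        exact ⟨i, j, k, hij, hki.symm, hkj.symm, rfl⟩
      have hrest : (K \ {i, j, k}).card = 3 := by
        rw [Finset.card_sdiff_of_subset hsub, hcard, hc3]
      obtain ⟨l, m, n, hlm, hln, hmn, hlmn⟩ := Finset.card_eq_three.1 hrest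
      have hmem : ∀ x, x ∈ K ↔ (x = i ∨ x = j ∨ x = k) ∨ (x = l ∨ x = m ∨ x = n) := by
        intro x
        rw [← Finset.sdiff_union_of_subset hsub, hlmn]
        simp only [Finset.mem_union, Finset.mem_insert, Finset.mem_singleton]
        tauto
      have hl : l ∈ K := (hmem l).2 (by simp)
      have hm : m ∈ K := (hmem m).2 (by simp)
      have hn : n ∈ K := (hmem n).2 (by simp)
      let A : Fin 3 → Submodule (ZMod 2) M := ![W i, W j, W k]
      let B : Fin 3 → Submodule (ZMod 2) M := ![W l, W m, W n]
      have hdis : ∀ {x y z : ι}, x ∈ K → y ∈ K → z ∈ K → x ≠ y → x ≠ z → y ≠ z →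
          ∀ p q : Fin 3, p ≠ q → (![W x, W y, W z] : Fin 3 → Submodule (ZMod 2) M) p ⊓
            (![W x, W y, W z] : Fin 3 → Submodule (ZMod 2) M) q = ⊥ := by
        intro x y z hx hy hz hxy hxz hyz p q hpq
        fin_cases p <;> fin_cases q
        · exact absurd rfl hpq
        · exact h2 x hx y hy hxy
        · exact h2 x hx z hz hxz
        · exact h2 y hy x hx hxy.symm
        · exact absurd rfl hpq
        · exact h2 y hy z hz hyz
        · exact h2 z hz x hx hxz.symm
        · exact h2 z hz y hy hyz.symm
        · exact absurd rfl hpq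
      have hno := not_cover_of_dependent hM (A := A) (B := B) (a := ![a, b, c])
        (by intro p; fin_cases p; exacts [hK i hi, hK j hj, hK k hk])
        (by intro p; fin_cases p; exacts [hK l hl, hK m hm, hK n hn])
        (hdis hi hj hk hij hki.symm hkj.symm) (hdis hl hm hn hlm hln hmn)
        (by intro p; fin_cases p; exacts [ha, hb, hc])
        (by intro p; fin_cases p; exacts [ha0, hb0, hc0]) habc
      have hAB : ∀ x ∈ K, (∃ p, W x = A p) ∨ ∃ p, W x = B p := by
        intro x hx
        obtain (rfl | rfl | rfl) | (rfl | rfl | rfl) := (hmem x).1 hx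
        · exact Or.inl ⟨0, rfl⟩
        · exact Or.inl ⟨1, rfl⟩
        · exact Or.inl ⟨2, rfl⟩
        · exact Or.inr ⟨0, rfl⟩
        · exact Or.inr ⟨1, rfl⟩
        · exact Or.inr ⟨2, rfl⟩
      by_contra hge
      have hMc : Fintype.card M = 128 := by
        rw [← Nat.card_eq_fintype_card, Module.natCard_eq_pow_finrank (K := ZMod 2), hM,
          Nat.card_zmod]
        norm_num
      have huniv : pairCover W K = Finset.univ := by
        apply Finset.eq_univ_of_card
        exact le_antisymm (Finset.card_le_univ _) (by omega)
      apply hno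
      intro v
      have hv : v ∈ pairCover W K := huniv ▸ Finset.mem_univ v
      obtain rfl | ⟨x, hx, y, hy, h⟩ := mem_pairCover.1 hv
      · exact Or.inl ⟨0, 0, zero_mem _⟩
      · obtain ⟨p, hp⟩ | ⟨p, hp⟩ := hAB x hx <;> obtain ⟨q, hq⟩ | ⟨q, hq⟩ := hAB y hy <;>
          rw [hp, hq] at h
        · exact Or.inl ⟨p, q, h⟩
        · exact Or.inr (Or.inl ⟨p, q, h⟩)
        · exact Or.inr (Or.inl ⟨q, p, sup_comm (B p) (A q) ▸ h⟩)
        · exact Or.inr (Or.inr ⟨p, q, h⟩)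
  · push Not at h2
    obtain ⟨i, hi, j, hj, hij, h⟩ := h2
    have e1 := card_pairCover_le_of_meeting hK hi hj hij h
    have e2 := card_pairCover_le_of_card_five (K := K.erase i) (W := W) hM
      (by rw [Finset.card_erase_of_mem hi, hcard])
      fun l hl => hK l (Finset.mem_of_mem_erase hl)
    rw [hcard] at e1
    omega

end LineFamilies

/-! ### Requests gained from pairs with nonlinear buckets. -/

section Buckets

variable {s m : ℕ} {E : ArrayEncoder s m 2}

theorem finrank_recoverable_pair_le (b c : Fin m) :
    finrank (ZMod 2) (recoverable E {b, c}) ≤ 4 := by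
  have h1 := finrank_recoverable_le (E := E) {b, c}
  have h2 := Finset.card_le_two (a := b) (b := c)
  omega

theorem recoverable_pair_comm (b c : Fin m) : recoverable E {b, c} = recoverable E {c, b} := by
  rw [Finset.pair_comm]

theorem ne_of_finrank_eq_four {b c : Fin m} (h : finrank (ZMod 2) (recoverable E {b, c}) = 4) :
    b ≠ c := by
  rintro rfl
  have h1 := finrank_recoverable_le (E := E) {b, b}
  rw [h] at h1
  simp at h1

theorem recoverable_pair_eq_sup_of_full {b c : Fin m}
    (h : finrank (ZMod 2) (recoverable E {b, c}) = 4) :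
    recoverable E {b, c} = bucketSpan E b ⊔ bucketSpan E c :=
  recoverable_pair_eq_sup (ne_of_finrank_eq_four h) h

theorem three_le_finrank_bucketSpan {b c : Fin m}
    (h : finrank (ZMod 2) (recoverable E {b, c}) = 4)
    (hb : finrank (ZMod 2) (recoverable E {b}) ≠ 2) :
    3 ≤ finrank (ZMod 2) (bucketSpan E b) :=
  lt_finrank_bucketSpan (ne_of_finrank_eq_four h) h hb

theorem recoverable_singleton_le_pair (b c : Fin m) :
    recoverable E {c} ≤ recoverable E {b, c} := recoverable_mono (by simp)

theorem card_pair_sdiff_le_four {b c : Fin m} {T : Finset (Fin s → ZMod 2)}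
    (hc : finrank (ZMod 2) (recoverable E {c}) = 2) (hT : pts (recoverable E {c}) ⊆ T)
    (h : finrank (ZMod 2) (recoverable E {b, c}) ≠ 4) :
    (pts (recoverable E {b, c}) \ T).card ≤ 4 := by
  have := finrank_recoverable_pair_le (E := E) b c
  exact card_pts_sdiff_le_of_le (n := 3) (k := 2) (recoverable_singleton_le_pair b c) hT
    (by omega) hc.ge

theorem card_sdiff_le_of_zero_mem {A : Submodule (ZMod 2) (Fin s → ZMod 2)} {n : ℕ}
    {T : Finset (Fin s → ZMod 2)} (hT : 0 ∈ T) (h : finrank (ZMod 2) A ≤ n) :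
    (pts A \ T).card ≤ 2 ^ n - 1 :=
  card_pts_sdiff_le_of_le (A := ⊥) (n := n) (k := 0) bot_le
    (by intro v hv; rw [(mem_bot _).1 (mem_pts.1 hv)]; exact hT) h (Nat.zero_le _)

/-- Two nonlinear buckets, each in a covered full pair. -/
theorem card_pair_sdiff_le_six {b c b' c' : Fin m} {T : Finset (Fin s → ZMod 2)}
    (hb : finrank (ZMod 2) (recoverable E {b}) ≠ 2)
    (hc : finrank (ZMod 2) (recoverable E {c}) ≠ 2)
    (hbb : finrank (ZMod 2) (recoverable E {b, b'}) = 4)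
    (hcc : finrank (ZMod 2) (recoverable E {c, c'}) = 4)
    (hbT : pts (recoverable E {b, b'}) ⊆ T) (hcT : pts (recoverable E {c, c'}) ⊆ T) :
    (pts (recoverable E {b, c}) \ T).card ≤ 6 := by
  have ub : bucketSpan E b ≤ recoverable E {b, b'} := by
    rw [recoverable_pair_eq_sup_of_full hbb]
    exact le_sup_left
  have uc : bucketSpan E c ≤ recoverable E {c, c'} := by
    rw [recoverable_pair_eq_sup_of_full hcc]
    exact le_sup_left
  by_cases h : finrank (ZMod 2) (recoverable E {b, c}) = 4
  · exact card_sup_sdiff_le_six (recoverable_pair_eq_sup_of_full h) ((pts_mono ub).trans hbT)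
      ((pts_mono uc).trans hcT) h (three_le_finrank_bucketSpan hbb hb)
      (three_le_finrank_bucketSpan hcc hc)
  · have h1 := finrank_recoverable_pair_le (E := E) b c
    refine card_sdiff_le_six_of_sup hbT (by omega) hbb ?_
    -- Three buckets have six cells, so the two recovery spaces together span at most six dimensions
    -- and overlap.
    have h2 : recoverable E {b, c} ⊔ recoverable E {b, b'} ≤ recoverable E {b, c, b'} :=
      sup_le (recoverable_mono (by intro x; simp; tauto))
        (recoverable_mono (by intro x; simp; tauto))
    have h3 := finrank_recoverable_le (E := E) {b, c, b'}
    have h4 := Finset.card_le_three (a := b) (b := c) (c := b')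
    have h5 := Submodule.finrank_mono h2
    omega

/-- A nonlinear bucket in a covered full pair, and any other bucket. -/
theorem card_pair_sdiff_le_eight {b c b' : Fin m} {T : Finset (Fin s → ZMod 2)} (h0 : 0 ∈ T)
    (hb : finrank (ZMod 2) (recoverable E {b}) ≠ 2)
    (hbb : finrank (ZMod 2) (recoverable E {b, b'}) = 4)
    (hbT : pts (recoverable E {b, b'}) ⊆ T) :
    (pts (recoverable E {b, c}) \ T).card ≤ 8 := by
  have h1 := finrank_recoverable_pair_le (E := E) b c
  by_cases h : finrank (ZMod 2) (recoverable E {b, c}) = 4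
  · have ub : bucketSpan E b ≤ recoverable E {b, b'} := by
      rw [recoverable_pair_eq_sup_of_full hbb]
      exact le_sup_left
    have ub' : bucketSpan E b ≤ recoverable E {b, c} := by
      rw [recoverable_pair_eq_sup_of_full h]
      exact le_sup_left
    exact card_pts_sdiff_le_of_le (n := 4) (k := 3) ub' ((pts_mono ub).trans hbT) h.le
      (three_le_finrank_bucketSpan hbb hb)
  · have := card_sdiff_le_of_zero_mem (n := 3) h0
      (show finrank (ZMod 2) (recoverable E {b, c}) ≤ 3 by omega)
    omega

variable (E) in
/-- The requests recovered by pairs of bucket `b` and a bucket in `L`. -/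
noncomputable def starPts (L : Finset (Fin m)) (b : Fin m) : Finset (Fin s → ZMod 2) :=
  L.biUnion fun c => pts (recoverable E {b, c})

variable {L : Finset (Fin m)} {b : Fin m}

theorem card_starPts_sdiff_le {T : Finset (Fin s → ZMod 2)} {n : Fin m → ℕ}
    (h : ∀ c ∈ L, (pts (recoverable E {b, c}) \ T).card ≤ n c) :
    (starPts E L b \ T).card ≤ ∑ c ∈ L, n c := by
  have : starPts E L b \ T ⊆ L.biUnion fun c => pts (recoverable E {b, c}) \ T := by
    intro v hv
    simp only [starPts, Finset.mem_sdiff, Finset.mem_biUnion] at hv ⊢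
    obtain ⟨⟨c, hc, hv⟩, hT⟩ := hv
    exact ⟨c, hc, hv, hT⟩
  exact (Finset.card_le_card this).trans (Finset.card_biUnion_le.trans (Finset.sum_le_sum h))

theorem card_starPts_sdiff_le_of_not_full
    (hL : ∀ c ∈ L, finrank (ZMod 2) (recoverable E {c}) = 2)
    (hb : ∀ c ∈ L, finrank (ZMod 2) (recoverable E {b, c}) ≠ 4) :
    (starPts E L b \ pairCover (fun c => recoverable E {c}) L).card ≤ 4 * L.card := by
  have := card_starPts_sdiff_le (n := fun _ => 4) fun c hc => card_pair_sdiff_le_four (hL c hc)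
    (pts_subset_pairCover (W := fun c => recoverable E {c}) hc) (hb c hc)
  rw [Finset.sum_const, smul_eq_mul] at this
  omega

/-- All full pairs at `b` recover the same space, which is paid for once: at most 12 new points, and
four for each linear bucket other than `c₀`. -/
theorem card_starPts_sdiff_le_of_finrank_four (hbL : finrank (ZMod 2) (bucketSpan E b) = 4)
    (hL : ∀ c ∈ L, finrank (ZMod 2) (recoverable E {c}) = 2) {c₀ : Fin m} (hc₀ : c₀ ∈ L)
    (hfull : finrank (ZMod 2) (recoverable E {b, c₀}) = 4) :
    (starPts E L b \ pairCover (fun c => recoverable E {c}) L).card ≤ 8 + 4 * L.card := by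
  have heq : ∀ c, finrank (ZMod 2) (recoverable E {b, c}) = 4 →
      recoverable E {b, c} = bucketSpan E b := by
    intro c hc
    symm
    apply Submodule.eq_of_le_of_finrank_eq
    · rw [recoverable_pair_eq_sup_of_full hc]
      exact le_sup_left
    · rw [hbL, hc]
  have hle : recoverable E {c₀} ≤ bucketSpan E b := by
    rw [← heq c₀ hfull]
    exact recoverable_singleton_le_pair b c₀
  set B := pairCover (fun c => recoverable E {c}) L with hB
  have h1 : (pts (bucketSpan E b) \ B).card ≤ 12 :=
    card_pts_sdiff_le_of_le (n := 4) (k := 2) hle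
      (pts_subset_pairCover (W := fun c => recoverable E {c}) hc₀) hbL.le (hL c₀ hc₀).ge
  have h2 := card_starPts_sdiff_le (E := E) (L := L) (b := b) (T := B ∪ pts (bucketSpan E b))
    (n := fun c => if c = c₀ then 0 else 4) (by
      intro c hc
      by_cases hf : finrank (ZMod 2) (recoverable E {b, c}) = 4
      · rw [heq c hf, Finset.sdiff_eq_empty_iff_subset.2 Finset.subset_union_right]
        simp
      · rw [if_neg (by rintro rfl; exact hf hfull)]
        exact card_pair_sdiff_le_four (hL c hc)
          ((pts_subset_pairCover (W := fun c => recoverable E {c}) hc).trans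
            Finset.subset_union_left) hf)
  rw [← Finset.add_sum_erase L _ hc₀, if_pos rfl,
    Finset.sum_congr rfl (fun i hi => if_neg (Finset.ne_of_mem_erase hi)), Finset.sum_const,
    Finset.card_erase_of_mem hc₀, smul_eq_mul] at h2
  have h3 : starPts E L b \ B ⊆
      (pts (bucketSpan E b) \ B) ∪ (starPts E L b \ (B ∪ pts (bucketSpan E b))) := by
    intro v hv
    simp only [Finset.mem_sdiff, Finset.mem_union] at hv ⊢
    tauto
  have h4 := (Finset.card_le_card h3).trans (Finset.card_union_le _ _)
  have h5 : 0 < L.card := Finset.card_pos.2 ⟨c₀, hc₀⟩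
  omega

/-- Once the span of `b` is paid for, a full pair adds at most 16 - 8 - 4 + 2 = 6 points and any
other pair at most four. -/
theorem card_starPts_sdiff_le_of_finrank_three (hbL : finrank (ZMod 2) (bucketSpan E b) = 3)
    (hL : ∀ c ∈ L, finrank (ZMod 2) (recoverable E {c}) = 2) :
    (starPts E L b \ pairCover (fun c => recoverable E {c}) L).card ≤
      (pts (bucketSpan E b) \ pairCover (fun c => recoverable E {c}) L).card + 4 * L.card
        + 2 * (L.filter fun c => finrank (ZMod 2) (recoverable E {b, c}) = 4).card := by
  set B := pairCover (fun c => recoverable E {c}) L with hB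
  have hsub : ∀ c ∈ L, pts (recoverable E {c}) ⊆ B ∪ pts (bucketSpan E b) := fun c hc =>
    (pts_subset_pairCover (W := fun c => recoverable E {c}) hc).trans Finset.subset_union_left
  have h2 := card_starPts_sdiff_le (E := E) (L := L) (b := b) (T := B ∪ pts (bucketSpan E b))
    (n := fun c => 4 + if finrank (ZMod 2) (recoverable E {b, c}) = 4 then 2 else 0) (by
      intro c hc
      by_cases hf : finrank (ZMod 2) (recoverable E {b, c}) = 4
      · rw [if_pos hf]
        have hs := recoverable_pair_eq_sup_of_full hf
        rw [bucketSpan_eq_recoverable (hL c hc)] at hs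
        exact card_sup_sdiff_le_six' hs Finset.subset_union_right (hsub c hc) hf hbL.ge (hL c hc)
      · rw [if_neg hf]
        exact card_pair_sdiff_le_four (hL c hc) (hsub c hc) hf)
  rw [Finset.sum_add_distrib, Finset.sum_const, smul_eq_mul, ← Finset.sum_filter,
    Finset.sum_const, smul_eq_mul] at h2
  have h3 : starPts E L b \ B ⊆
      (pts (bucketSpan E b) \ B) ∪ (starPts E L b \ (B ∪ pts (bucketSpan E b))) := by
    intro v hv
    simp only [Finset.mem_sdiff, Finset.mem_union] at hv ⊢
    tauto
  have h4 := (Finset.card_le_card h3).trans (Finset.card_union_le _ _)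
  omega

theorem bucketSpan_inf_ne_bot {c : Fin m} (hbL : finrank (ZMod 2) (bucketSpan E b) = 3)
    (hc : finrank (ZMod 2) (recoverable E {c}) = 2)
    (hfull : finrank (ZMod 2) (recoverable E {b, c}) = 4) :
    bucketSpan E b ⊓ recoverable E {c} ≠ ⊥ := by
  intro h
  have h1 := finrank_sup_add (bucketSpan E b) (recoverable E {c})
  have hs := recoverable_pair_eq_sup_of_full hfull
  rw [bucketSpan_eq_recoverable hc] at hs
  rw [← hs, hfull, h, finrank_bot, hbL, hc] at h1
  omega

theorem finrank_bucketSpan_cases {c : Fin m}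
    (hb : finrank (ZMod 2) (recoverable E {b}) ≠ 2)
    (hfull : finrank (ZMod 2) (recoverable E {b, c}) = 4) :
    finrank (ZMod 2) (bucketSpan E b) = 3 ∨ finrank (ZMod 2) (bucketSpan E b) = 4 := by
  have h1 := three_le_finrank_bucketSpan hfull hb
  have ub : bucketSpan E b ≤ recoverable E {b, c} := by
    rw [recoverable_pair_eq_sup_of_full hfull]
    exact le_sup_left
  have h2 := Submodule.finrank_mono ub
  omega

theorem card_starPts_sdiff_le_of_full (hb : finrank (ZMod 2) (recoverable E {b}) ≠ 2)
    (hL : ∀ c ∈ L, finrank (ZMod 2) (recoverable E {c}) = 2)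
    {c₀ : Fin m} (hc₀ : c₀ ∈ L) (hfull : finrank (ZMod 2) (recoverable E {b, c₀}) = 4) :
    (starPts E L b \ pairCover (fun c => recoverable E {c}) L).card ≤ 6 + 6 * L.card := by
  have h5 : 0 < L.card := Finset.card_pos.2 ⟨c₀, hc₀⟩
  obtain h | h := finrank_bucketSpan_cases hb hfull
  · have h1 := card_starPts_sdiff_le_of_finrank_three h hL
    have h2 := Finset.card_filter_le L fun c => finrank (ZMod 2) (recoverable E {b, c}) = 4
    have h3 : (pts (bucketSpan E b) \ pairCover (fun c => recoverable E {c}) L).card ≤ 6 :=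
      card_pts_sdiff_le_of_le (A := bucketSpan E b ⊓ recoverable E {c₀}) (n := 3) (k := 1)
        inf_le_left ((pts_mono inf_le_right).trans
          (pts_subset_pairCover (W := fun c => recoverable E {c}) hc₀)) h.le
        (finrank_inf_pos_of_ne_bot (bucketSpan_inf_ne_bot h (hL c₀ hc₀) hfull))
    omega
  · have h1 := card_starPts_sdiff_le_of_finrank_four h hL hc₀ hfull
    omega

/-- If the linear buckets are pairwise disjoint, a nonlinear bucket adds few requests. -/
theorem card_starPts_sdiff_le_of_disjoint (hb : finrank (ZMod 2) (recoverable E {b}) ≠ 2)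
    (hL : ∀ c ∈ L, finrank (ZMod 2) (recoverable E {c}) = 2) (hcard : L.card ≤ 5)
    (hdisj : ∀ c ∈ L, ∀ d ∈ L, c ≠ d → recoverable E {c} ⊓ recoverable E {d} = ⊥)
    {c₀ : Fin m} (hc₀ : c₀ ∈ L) (hfull : finrank (ZMod 2) (recoverable E {b, c₀}) = 4) :
    (starPts E L b \ pairCover (fun c => recoverable E {c}) L).card ≤ 10 + 4 * L.card := by
  obtain h | h := finrank_bucketSpan_cases hb hfull
  swap
  · have h1 := card_starPts_sdiff_le_of_finrank_four h hL hc₀ hfull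
    omega
  have h1 := card_starPts_sdiff_le_of_finrank_three h hL
  set F := L.filter fun c => finrank (ZMod 2) (recoverable E {b, c}) = 4 with hF
  have hFL : F.card ≤ L.card := Finset.card_filter_le _ _
  set B := pairCover (fun c => recoverable E {c}) L with hB
  have hex : ∀ c, ∃ p, c ∈ F → p ∈ bucketSpan E b ∧ p ∈ recoverable E {c} ∧ p ≠ 0 := by
    intro c
    by_cases hc : c ∈ F
    · obtain ⟨hcL, hcf⟩ := Finset.mem_filter.1 hc
      obtain ⟨p, hp, hp0⟩ := Submodule.exists_mem_ne_zero_of_ne_bot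
        (bucketSpan_inf_ne_bot h (hL c hcL) hcf)
      exact ⟨p, fun _ => ⟨hp.1, hp.2, hp0⟩⟩
    · exact ⟨0, fun h => absurd h hc⟩
  choose o ho using hex
  set O := F.image o with hO
  have hOcard : O.card = F.card := by
    apply Finset.card_image_of_injOn
    intro c hc d hd hcd
    by_contra hne
    have h2 : o c ∈ recoverable E {c} ⊓ recoverable E {d} := by
      refine ⟨(ho c hc).2.1, ?_⟩
      change o c ∈ recoverable E {d}
      rw [show o c = o d from hcd]
      exact (ho d hd).2.1
    rw [hdisj c (Finset.mem_filter.1 hc).1 d (Finset.mem_filter.1 hd).1 hne, mem_bot] at h2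
    exact (ho c hc).2.2 h2
  have hOU : ∀ p ∈ O, p ∈ bucketSpan E b ∧ p ≠ 0 ∧ ∃ c ∈ L, p ∈ recoverable E {c} := by
    intro p hp
    obtain ⟨c, hc, rfl⟩ := Finset.mem_image.1 hp
    exact ⟨(ho c hc).1, (ho c hc).2.2, c, (Finset.mem_filter.1 hc).1, (ho c hc).2.1⟩
  have h0O : (0 : Fin s → ZMod 2) ∉ O := fun h0 => (hOU 0 h0).2.1 rfl
  have hU8 : (pts (bucketSpan E b)).card = 8 := by
    rw [card_pts, h]
    norm_num
  -- `O` has one point of the span of `b` on each linear bucket in a full pair with `b`. If there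
  -- are four, the span is wholly covered: for an uncovered `p`, the sets `O` and `p + O` would be
  -- disjoint, yet only six points differ from zero and `p`.
  by_cases h4 : 4 ≤ F.card
  · have hUB : pts (bucketSpan E b) ⊆ B := by
      intro p hp
      rw [mem_pts] at hp
      by_cases hp0 : p = 0
      · rw [hp0]
        exact zero_mem_pairCover
      by_cases hpO : p ∈ O
      · obtain ⟨-, -, c, hc, hpc⟩ := hOU p hpO
        exact pts_subset_pairCover (W := fun c => recoverable E {c}) hc (mem_pts.2 hpc)
      by_contra hpB
      have hdis : Disjoint O (O.image fun q => p + q) := by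
        rw [Finset.disjoint_left]
        intro q hq hq'
        obtain ⟨r, hr, rfl⟩ := Finset.mem_image.1 hq'
        obtain ⟨-, -, c, hc, hqc⟩ := hOU _ hq
        obtain ⟨-, -, d, hd, hrd⟩ := hOU _ hr
        apply hpB
        refine pts_sup_subset_pairCover (W := fun c => recoverable E {c}) hc hd (mem_pts.2 ?_)
        have : p = (p + r) + r := by rw [add_assoc, add_self_of_two, add_zero]
        rw [this]
        exact add_mem (mem_sup_left hqc) (mem_sup_right hrd)
      have hsub : O ∪ O.image (fun q => p + q) ⊆ ((pts (bucketSpan E b)).erase 0).erase p := by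
        intro q hq
        simp only [Finset.mem_erase, mem_pts]
        obtain hq' | hq' := Finset.mem_union.1 hq
        · refine ⟨?_, (hOU q hq').2.1, (hOU q hq').1⟩
          rintro rfl
          exact hpO hq'
        · obtain ⟨r, hr, rfl⟩ := Finset.mem_image.1 hq'
          refine ⟨?_, ?_, add_mem hp (hOU r hr).1⟩
          · intro h
            exact (hOU r hr).2.1 (by simpa using h)
          · intro h
            rw [eq_of_add_eq_zero_of_two h] at hpO
            exact hpO hr
      have hcl := Finset.card_le_card hsub
      rw [Finset.card_union_of_disjoint hdis,
        Finset.card_image_of_injective _ (add_right_injective p),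
        Finset.card_erase_of_mem (Finset.mem_erase.2 ⟨hp0, mem_pts.2 hp⟩),
        Finset.card_erase_of_mem (mem_pts.2 (zero_mem _)), hU8] at hcl
      omega
    rw [Finset.sdiff_eq_empty_iff_subset.2 hUB, Finset.card_empty] at h1
    omega
  -- With at most three full pairs, the known points save `1 + F.card` of the eight points of the
  -- span.
  · have h2 := card_pts_sdiff_add_card_le (V := bucketSpan E b) (X := insert 0 O) (T := B)
      (by
        intro p hp
        rw [mem_pts]
        obtain rfl | hp := Finset.mem_insert.1 hp
        · exact zero_mem _
        · exact (hOU p hp).1)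
      (by
        intro p hp
        obtain rfl | hp := Finset.mem_insert.1 hp
        · exact zero_mem_pairCover
        · obtain ⟨-, -, c, hc, hpc⟩ := hOU p hp
          exact pts_subset_pairCover (W := fun c => recoverable E {c}) hc (mem_pts.2 hpc))
    rw [Finset.card_insert_of_notMem h0O, h, hOcard] at h2
    omega

end Buckets

/-! ### The counting bound for a mixture of linear and nonlinear buckets. -/

theorem exists_maximal_matching {ι : Type*} [DecidableEq ι] (K : Finset ι)
    (p : Finset ι → Prop) : ∃ F : Finset (Finset ι), F ⊆ K.powersetCard 2 ∧ (∀ e ∈ F, p e) ∧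
      (F.biUnion id).card = 2 * F.card ∧
      ∀ e ∈ (K \ F.biUnion id).powersetCard 2, ¬ p e := by
  classical
  let 𝓕 := (K.powersetCard 2).powerset.filter fun F =>
    (∀ e ∈ F, p e) ∧ ∀ e ∈ F, ∀ f ∈ F, e ≠ f → Disjoint e f
  have hne : 𝓕.Nonempty := ⟨∅, by simp [𝓕]⟩
  obtain ⟨F, hF, hmax⟩ := Finset.exists_max_image 𝓕 Finset.card hne
  simp only [𝓕, Finset.mem_filter, Finset.mem_powerset] at hF hmax
  obtain ⟨hFK, hFp, hFd⟩ := hF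
  refine ⟨F, hFK, hFp, ?_, ?_⟩
  · rw [Finset.card_biUnion (t := id) fun e he f hf hef => hFd e he f hf hef, mul_comm]
    exact Finset.sum_const_nat fun e he => (Finset.mem_powersetCard.1 (hFK he)).2
  · intro e he hpe
    obtain ⟨heK, he2⟩ := Finset.mem_powersetCard.1 he
    have hdis : ∀ f ∈ F, Disjoint e f := by
      intro f hf
      rw [Finset.disjoint_left]
      intro x hx hxf
      exact (Finset.mem_sdiff.1 (heK hx)).2 (Finset.mem_biUnion.2 ⟨f, hf, hxf⟩)
    have heF : e ∉ F := by
      intro h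
      have := hdis e h
      rw [disjoint_self, Finset.bot_eq_empty] at this
      rw [this] at he2
      simp at he2
    have h1 := hmax (insert e F) ⟨?_, ?_, ?_⟩
    · rw [Finset.card_insert_of_notMem heF] at h1
      omega
    · apply Finset.insert_subset _ hFK
      rw [Finset.mem_powersetCard]
      exact ⟨heK.trans Finset.sdiff_subset, he2⟩
    · intro f hf
      obtain rfl | hf := Finset.mem_insert.1 hf
      · exact hpe
      · exact hFp f hf
    · intro f hf g hg hfg
      obtain rfl | hf' := Finset.mem_insert.1 hf <;> obtain rfl | hg' := Finset.mem_insert.1 hg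
      · exact absurd rfl hfg
      · exact hdis g hg'
      · exact (hdis f hf').symm
      · exact hFd f hf' g hg' hfg

section Count

variable {s m : ℕ} {E : ArrayEncoder s m 2}

/-- The counting bound: `L` is a set of linear buckets, the buckets outside are nonlinear, and `a`
of these form a full pair with a bucket in `L`, each adding at most `x` requests. -/
theorem exists_count (L : Finset (Fin m)) (hL : ∀ c, c ∈ L ↔ finrank (ZMod 2) (recoverable E {c}) = 2)
    (hcov : ∀ v, ∃ b c, b ≠ c ∧ v ∈ recoverable E {b, c}) {x : ℕ}
    (hx : ∀ b ∉ L, (∃ c ∈ L, finrank (ZMod 2) (recoverable E {b, c}) = 4) →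
      (starPts E L b \ pairCover (fun c => recoverable E {c}) L).card ≤ x) :
    ∃ a q k, L.card + a + 2 * q + k = m ∧ (L.card = 0 → a = 0) ∧
      2 ^ s ≤ (pairCover (fun c => recoverable E {c}) L).card + (a * x + (2 * q + k) * (4 * L.card))
        + q * 15 + ((a + 2 * q).choose 2 - q) * 6 + k.choose 2 * 7
        + ((a + 2 * q + k).choose 2 - ((a + 2 * q).choose 2 + k.choose 2)) * 8 := by
  classical
  set B := pairCover (fun c => recoverable E {c}) L with hB
  set N := Finset.univ \ L with hN
  have hNL : ∀ {b}, b ∈ N → b ∉ L := fun hb => (Finset.mem_sdiff.1 hb).2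
  -- The nonlinear buckets split into `α`, with a full linear partner, `D`, matched in full pairs,
  -- and the rest `K`, in which maximality leaves no full pair.
  set α := N.filter fun b => ∃ c ∈ L, finrank (ZMod 2) (recoverable E {b, c}) = 4 with hα
  have hαN : α ⊆ N := Finset.filter_subset _ _
  obtain ⟨F, hFsub, hFfull, hFcard, hFmax⟩ := exists_maximal_matching (N \ α)
    fun e => finrank (ZMod 2) (recoverable E e) = 4
  set D := F.biUnion id with hD
  have hDsub : D ⊆ N \ α := by
    intro b hb
    obtain ⟨e, he, hbe⟩ := Finset.mem_biUnion.1 hb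
    exact (Finset.mem_powersetCard.1 (hFsub he)).1 hbe
  set A := α ∪ D with hA
  set K := (N \ α) \ D with hK
  have hAD : Disjoint α D := Finset.disjoint_of_subset_right hDsub Finset.disjoint_sdiff
  have hAcard : A.card = α.card + 2 * F.card := by
    rw [hA, Finset.card_union_of_disjoint hAD, hFcard]
  have hβcard : (N \ α).card = 2 * F.card + K.card := by
    have := Finset.card_sdiff_add_card_eq_card hDsub
    rw [← hK] at this
    omega
  have hNcard : N.card = α.card + 2 * F.card + K.card := by
    have := Finset.card_sdiff_add_card_eq_card hαN
    omega
  have hAN : A ⊆ N := Finset.union_subset hαN (hDsub.trans Finset.sdiff_subset)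
  have hKN : K ⊆ N := Finset.sdiff_subset.trans Finset.sdiff_subset
  have hAK : Disjoint A K := by
    rw [Finset.disjoint_left]
    intro b hb hbK
    simp only [hK, Finset.mem_sdiff] at hbK
    obtain hb | hb := Finset.mem_union.1 hb
    · exact hbK.1.2 hb
    · exact hbK.2 hb
  refine ⟨α.card, F.card, K.card, ?_, ?_, ?_⟩
  · have := Finset.card_sdiff_add_card_eq_card (Finset.subset_univ L)
    rw [Finset.card_univ, Fintype.card_fin, ← hN] at this
    omega
  · intro hL0
    rw [Finset.card_eq_zero] at hL0 ⊢
    rw [hα, Finset.filter_eq_empty_iff]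
    rintro b - ⟨c, hc, -⟩
    rw [hL0] at hc
    exact Finset.notMem_empty _ hc
  let P : Finset (Fin m) → Finset (Fin s → ZMod 2) := fun e => pts (recoverable E e)
  -- The order matters: stars and matching come first, so that each bucket of `A` lies in a full
  -- pair already covered when the other nonlinear pairs are counted.
  set B1 := B ∪ N.biUnion (starPts E L) with hB1
  set B2 := B1 ∪ F.biUnion P with hB2
  set B3 := B2 ∪ (A.powersetCard 2 \ F).biUnion P with hB3
  set B4 := B3 ∪ (K.powersetCard 2).biUnion P with hB4
  set EX := N.powersetCard 2 \ (A.powersetCard 2 ∪ K.powersetCard 2) with hEX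
  set B5 := B4 ∪ EX.biUnion P with hB5
  have z0 : (0 : Fin s → ZMod 2) ∈ B := zero_mem_pairCover
  have s01 : B ⊆ B1 := Finset.subset_union_left
  have s12 : B1 ⊆ B2 := Finset.subset_union_left
  have s23 : B2 ⊆ B3 := Finset.subset_union_left
  have s34 : B3 ⊆ B4 := Finset.subset_union_left
  have s45 : B4 ⊆ B5 := Finset.subset_union_left
  have hcovered : ∀ b ∈ A, b ∉ L ∧ ∃ c, finrank (ZMod 2) (recoverable E {b, c}) = 4 ∧
      pts (recoverable E {b, c}) ⊆ B2 := by
    intro b hb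
    refine ⟨hNL (hAN hb), ?_⟩
    obtain hb | hb := Finset.mem_union.1 hb
    · obtain ⟨hbN, c, hc, hf⟩ := Finset.mem_filter.1 hb
      refine ⟨c, hf, ?_⟩
      intro v hv
      exact s12 (Finset.mem_union_right _ (Finset.mem_biUnion.2
        ⟨b, hbN, Finset.mem_biUnion.2 ⟨c, hc, hv⟩⟩))
    · obtain ⟨e, he, hbe⟩ := Finset.mem_biUnion.1 hb
      rw [id] at hbe
      obtain ⟨c, hc⟩ := Finset.card_eq_one.1 (show (e.erase b).card = 1 by
        rw [Finset.card_erase_of_mem hbe, (Finset.mem_powersetCard.1 (hFsub he)).2])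
      have hebc : e = {b, c} := by rw [← Finset.insert_erase hbe, hc]
      refine ⟨c, hebc ▸ hFfull e he, ?_⟩
      rw [← hebc]
      intro v hv
      exact Finset.mem_union_right _ (Finset.mem_biUnion.2 ⟨e, he, hv⟩)
  have c1 : B1.card ≤ B.card + (α.card * x + (2 * F.card + K.card) * (4 * L.card)) := by
    have h := card_union_biUnion_le B N (starPts E L) (fun b => if b ∈ α then x else 4 * L.card) (by
      intro b hb
      split_ifs with hbα
      · exact hx b (hNL hb) (Finset.mem_filter.1 hbα).2
      · refine card_starPts_sdiff_le_of_not_full (fun c hc => (hL c).1 hc) fun c hc hf => ?_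
        exact hbα (Finset.mem_filter.2 ⟨hb, c, hc, hf⟩))
    rwa [Finset.sum_ite, Finset.sum_const, Finset.sum_const, smul_eq_mul, smul_eq_mul,
      Finset.filter_mem_eq_inter, Finset.inter_eq_right.2 hαN, Finset.filter_notMem_eq_sdiff,
      hβcard] at h
  have c2 : B2.card ≤ B1.card + F.card * 15 := by
    apply card_union_biUnion_le_mul
    intro e he
    exact card_sdiff_le_of_zero_mem (n := 4) (s01 z0) (hFfull e he).le
  have c3 : B3.card ≤ B2.card + ((α.card + 2 * F.card).choose 2 - F.card) * 6 := by
    have hFA : F ⊆ A.powersetCard 2 := by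
      intro e he
      rw [Finset.mem_powersetCard]
      refine ⟨?_, (Finset.mem_powersetCard.1 (hFsub he)).2⟩
      intro b hb
      exact Finset.mem_union_right _ (Finset.mem_biUnion.2 ⟨e, he, hb⟩)
    rw [← hAcard, ← Finset.card_powersetCard 2 A, ← Finset.card_sdiff_of_subset hFA]
    apply card_union_biUnion_le_mul
    intro e he
    obtain ⟨heA, he2⟩ := Finset.mem_powersetCard.1 (Finset.mem_sdiff.1 he).1
    obtain ⟨b, c, -, rfl⟩ := Finset.card_eq_two.1 he2
    obtain ⟨hb, b', hbb, hbT⟩ := hcovered b (heA (by simp))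
    obtain ⟨hc, c', hcc, hcT⟩ := hcovered c (heA (by simp))
    exact card_pair_sdiff_le_six (fun h => hb ((hL b).2 h)) (fun h => hc ((hL c).2 h)) hbb hcc
      hbT hcT
  have c4 : B4.card ≤ B3.card + K.card.choose 2 * 7 := by
    rw [← Finset.card_powersetCard]
    apply card_union_biUnion_le_mul
    intro e he
    have h1 := hFmax e he
    obtain ⟨heA, he2⟩ := Finset.mem_powersetCard.1 he
    obtain ⟨b, c, -, rfl⟩ := Finset.card_eq_two.1 he2
    have h2 := finrank_recoverable_pair_le (E := E) b c
    exact card_sdiff_le_of_zero_mem (n := 3) (s23 (s12 (s01 z0))) (by omega)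
  have c5 : B5.card ≤ B4.card + ((α.card + 2 * F.card + K.card).choose 2
      - ((α.card + 2 * F.card).choose 2 + K.card.choose 2)) * 8 := by
    have hdis : Disjoint (A.powersetCard 2) (K.powersetCard 2) := by
      rw [Finset.disjoint_left]
      intro e heA heK
      obtain ⟨h1, h2⟩ := Finset.mem_powersetCard.1 heA
      obtain ⟨h3, -⟩ := Finset.mem_powersetCard.1 heK
      have := Finset.disjoint_of_subset_left h1 (Finset.disjoint_of_subset_right h3 hAK)
      rw [disjoint_self, Finset.bot_eq_empty] at this
      rw [this] at h2
      simp at h2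
    have hsub : A.powersetCard 2 ∪ K.powersetCard 2 ⊆ N.powersetCard 2 :=
      Finset.union_subset (Finset.powersetCard_mono hAN) (Finset.powersetCard_mono hKN)
    rw [← hNcard, ← hAcard, ← Finset.card_powersetCard 2 A, ← Finset.card_powersetCard 2 K,
      ← Finset.card_powersetCard 2 N, ← Finset.card_union_of_disjoint hdis,
      ← Finset.card_sdiff_of_subset hsub]
    apply card_union_biUnion_le_mul
    intro e he
    obtain ⟨heN, heAK⟩ := Finset.mem_sdiff.1 he
    obtain ⟨heN, he2⟩ := Finset.mem_powersetCard.1 heN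
    obtain ⟨b, hbe, hbK⟩ : ∃ b ∈ e, b ∉ K := by
      by_contra! hcon
      exact heAK (Finset.mem_union_right _ (Finset.mem_powersetCard.2 ⟨hcon, he2⟩))
    have hbA : b ∈ A := by
      by_contra hbA
      simp only [hA, Finset.mem_union, not_or] at hbA
      exact hbK (Finset.mem_sdiff.2 ⟨Finset.mem_sdiff.2 ⟨heN hbe, hbA.1⟩, hbA.2⟩)
    obtain ⟨c, hc⟩ := Finset.card_eq_one.1 (show (e.erase b).card = 1 by
      rw [Finset.card_erase_of_mem hbe, he2])
    have hebc : e = {b, c} := by rw [← Finset.insert_erase hbe, hc]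
    obtain ⟨hb, b', hbb, hbT⟩ := hcovered b hbA
    rw [hebc]
    exact card_pair_sdiff_le_eight (s34 (s23 (s12 (s01 z0)))) (fun h => hb ((hL b).2 h)) hbb
      (hbT.trans (s23.trans s34))
  have hall : (Finset.univ : Finset (Fin s → ZMod 2)) ⊆ B5 := by
    intro v _
    obtain ⟨b, c, hbc, hv⟩ := hcov v
    have hstar : ∀ {b c}, b ∉ L → c ∈ L → v ∈ recoverable E {b, c} → v ∈ B5 := by
      intro b c hb hc hv
      refine s45 (s34 (s23 (s12 (Finset.mem_union_right _ (Finset.mem_biUnion.2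
        ⟨b, Finset.mem_sdiff.2 ⟨Finset.mem_univ _, hb⟩,
          Finset.mem_biUnion.2 ⟨c, hc, mem_pts.2 hv⟩⟩)))))
    by_cases hb : b ∈ L <;> by_cases hc : c ∈ L
    · refine s45 (s34 (s23 (s12 (s01 (pts_sup_subset_pairCover
        (W := fun c => recoverable E {c}) hb hc (mem_pts.2 ?_))))))
      rw [← recoverable_pair_of_linear ((hL b).1 hb) ((hL c).1 hc)]
      exact hv
    · rw [recoverable_pair_comm] at hv
      exact hstar hc hb hv
    · exact hstar hb hc hv
    · have heN : ({b, c} : Finset (Fin m)) ∈ N.powersetCard 2 := by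
        rw [Finset.mem_powersetCard]
        exact ⟨by simp [Finset.insert_subset_iff, hN, hb, hc], Finset.card_pair hbc⟩
      have hvP : v ∈ P {b, c} := mem_pts.2 hv
      by_cases h1 : ({b, c} : Finset (Fin m)) ∈ EX
      · exact Finset.mem_union_right _ (Finset.mem_biUnion.2 ⟨_, h1, hvP⟩)
      · have h2 : ({b, c} : Finset (Fin m)) ∈ A.powersetCard 2 ∪ K.powersetCard 2 := by
          by_contra h2
          exact h1 (Finset.mem_sdiff.2 ⟨heN, h2⟩)
        obtain h2 | h2 := Finset.mem_union.1 h2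
        · by_cases h3 : ({b, c} : Finset (Fin m)) ∈ F
          · exact s45 (s34 (s23 (Finset.mem_union_right _ (Finset.mem_biUnion.2 ⟨_, h3, hvP⟩))))
          · exact s45 (s34 (Finset.mem_union_right _ (Finset.mem_biUnion.2
              ⟨_, Finset.mem_sdiff.2 ⟨h2, h3⟩, hvP⟩)))
        · exact s45 (Finset.mem_union_right _ (Finset.mem_biUnion.2 ⟨_, h2, hvP⟩))
  have c6 := Finset.card_le_card hall
  rw [Finset.card_univ, Fintype.card_fun, ZMod.card, Fintype.card_fin] at c6
  omega

end Count

/-- The numerical content of the counting bound for at most five linear buckets. -/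
theorem count_lt {l a q k B x : ℕ} (hsum : l + a + 2 * q + k = 6) (ha0 : l = 0 → a = 0)
    (hB : (l ≤ 3 ∧ B ≤ 1 + 3 * l + 9 * l.choose 2 ∧ x ≤ 6 + 6 * l) ∨
      (l = 4 ∧ B ≤ 1 + 3 * 4 + 9 * Nat.choose 4 2 ∧ x ≤ 26) ∨ (l = 4 ∧ B ≤ 53 ∧ x ≤ 30) ∨
      (l = 5 ∧ B ≤ 97 ∧ x ≤ 30) ∨ (l = 5 ∧ B ≤ 89 ∧ x ≤ 36)) :
    ¬ 2 ^ 7 ≤ B + (a * x + (2 * q + k) * (4 * l)) + q * 15 + ((a + 2 * q).choose 2 - q) * 6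
      + k.choose 2 * 7
      + ((a + 2 * q + k).choose 2 - ((a + 2 * q).choose 2 + k.choose 2)) * 8 := by
  obtain rfl : k = 6 - l - a - 2 * q := by omega
  have ha : a ≤ 6 := by omega
  have hq : q ≤ 3 := by omega
  rcases hB with ⟨hl, h1, h2⟩ | ⟨rfl, h1, h2⟩ | ⟨rfl, h1, h2⟩ | ⟨rfl, h1, h2⟩ | ⟨rfl, h1, h2⟩
  -- There is little slack: three or five linear buckets, with full linear partners for all the
  -- others, give 127.
  · interval_cases l <;> interval_cases q <;> interval_cases a <;>
      first | omega | (norm_num [Nat.choose] at h1 h2 ⊢; omega)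
  all_goals interval_cases q <;> interval_cases a <;>
      first | omega | (norm_num [Nat.choose] at h1 h2 ⊢; omega)

theorem not_isLocalityFunctionalArrayCode_six (E : ArrayEncoder 7 6 2) :
    ¬ IsLocalityFunctionalArrayCode 7 1 6 2 2 E := by
  classical
  intro hE
  have hcov : ∀ v, ∃ b c, b ≠ c ∧ v ∈ recoverable E {b, c} := by
    intro v
    obtain ⟨S, -, hS⟩ := hE v
    obtain ⟨hS2, hSv⟩ := hS 0
    rw [isRecoveringSet_iff] at hSv
    -- Enlarging a recovering set is harmless, so exactly two buckets may be assumed.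
    obtain ⟨T, hST, hT⟩ := Finset.exists_superset_card_eq hS2 (by simp)
    obtain ⟨b, c, hbc, rfl⟩ := Finset.card_eq_two.1 hT
    exact ⟨b, c, hbc, recoverable_mono hST hSv⟩
  set L := Finset.univ.filter fun c => finrank (ZMod 2) (recoverable E {c}) = 2 with hLdef
  have hL : ∀ c, c ∈ L ↔ finrank (ZMod 2) (recoverable E {c}) = 2 := by
    intro c
    simp [L]
  have hL' : ∀ c ∈ L, finrank (ZMod 2) (recoverable E {c}) = 2 := fun c hc => (hL c).1 hc
  have hM : finrank (ZMod 2) (Fin 7 → ZMod 2) = 7 := by simp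
  have hl6 : L.card ≤ 6 := by simpa using Finset.card_le_univ L
  have hx : ∀ b ∉ L, (∃ c ∈ L, finrank (ZMod 2) (recoverable E {b, c}) = 4) →
      (starPts E L b \ pairCover (fun c => recoverable E {c}) L).card ≤ 6 + 6 * L.card := by
    rintro b hb ⟨c, hc, hf⟩
    exact card_starPts_sdiff_le_of_full (fun h => hb ((hL b).2 h)) hL' hc hf
  by_cases hl6' : L.card = 6
  · obtain ⟨a, q, k, hsum, ha0, h⟩ := exists_count L hL hcov hx
    have hB := card_pairCover_lt_of_card_six hM hl6' hL'
    obtain ⟨rfl, rfl, rfl⟩ : a = 0 ∧ q = 0 ∧ k = 0 := by omega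
    norm_num at h
    omega
  by_cases hl3 : L.card ≤ 3
  · obtain ⟨a, q, k, hsum, ha0, h⟩ := exists_count L hL hcov hx
    have hB := card_pairCover_le (W := fun c => recoverable E {c}) hL'
    exact count_lt hsum ha0 (Or.inl ⟨hl3, hB, le_rfl⟩) h
  -- For four or five linear buckets the crude bounds do not combine: disjointness lowers the gain
  -- per nonlinear bucket, while a meeting pair lowers the count of the linear part.
  by_cases hdisj : ∀ c ∈ L, ∀ d ∈ L, c ≠ d → recoverable E {c} ⊓ recoverable E {d} = ⊥
  · have hx' : ∀ b ∉ L, (∃ c ∈ L, finrank (ZMod 2) (recoverable E {b, c}) = 4) →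
        (starPts E L b \ pairCover (fun c => recoverable E {c}) L).card ≤ 10 + 4 * L.card := by
      rintro b hb ⟨c, hc, hf⟩
      exact card_starPts_sdiff_le_of_disjoint (fun h => hb ((hL b).2 h)) hL' (by omega) hdisj hc hf
    obtain ⟨a, q, k, hsum, ha0, h⟩ := exists_count L hL hcov hx'
    obtain hl | hl : L.card = 4 ∨ L.card = 5 := by omega
    · have hB := card_pairCover_le (W := fun c => recoverable E {c}) hL'
      rw [hl] at hB h hsum ha0
      exact count_lt hsum ha0 (Or.inr (Or.inl ⟨rfl, hB, by norm_num⟩)) h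
    · have hB := card_pairCover_le_of_card_five hM hl hL'
      rw [hl] at h hsum ha0
      exact count_lt hsum ha0 (Or.inr (Or.inr (Or.inr (Or.inl ⟨rfl, hB, by norm_num⟩)))) h
  · push Not at hdisj
    obtain ⟨c, hc, d, hd, hcd, hmeet⟩ := hdisj
    obtain ⟨a, q, k, hsum, ha0, h⟩ := exists_count L hL hcov hx
    have hB := card_pairCover_le_of_meeting hL' hc hd hcd hmeet
    have hB' := card_pairCover_le (K := L.erase c) (W := fun c => recoverable E {c})
      fun l hl => hL' l (Finset.mem_of_mem_erase hl)
    rw [Finset.card_erase_of_mem hc] at hB'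
    obtain hl | hl : L.card = 4 ∨ L.card = 5 := by omega
    · rw [hl] at hB hB' h hsum ha0
      norm_num [Nat.choose] at hB hB'
      exact count_lt hsum ha0 (Or.inr (Or.inr (Or.inl ⟨rfl, hB.trans (by omega), by norm_num⟩))) h
    · rw [hl] at hB hB' h hsum ha0
      norm_num [Nat.choose] at hB hB'
      exact count_lt hsum ha0 (Or.inr (Or.inr (Or.inr (Or.inr ⟨rfl, hB.trans (by omega), by norm_num⟩)))) h

/-! ### Reduction to six buckets, and the code with seven. -/

/-- Adding empty buckets to a code gives a code. -/
theorem exists_isLocalityFunctionalArrayCode_of_le {s k m n t r : ℕ} (hmn : m ≤ n)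
    {E : ArrayEncoder s m t} (hE : IsLocalityFunctionalArrayCode s k m t r E) :
    ∃ E' : ArrayEncoder s n t, IsLocalityFunctionalArrayCode s k n t r E' := by
  refine ⟨fun x b => if h : (b : ℕ) < m then E x ⟨b, h⟩ else 0, fun v => ?_⟩
  obtain ⟨S, hdis, hS⟩ := hE v
  refine ⟨fun j => (S j).map (Fin.castLEEmb hmn), ?_, fun j => ⟨?_, ?_⟩⟩
  · intro i j hij
    exact (Finset.disjoint_map _).2 (hdis i j hij)
  · rw [Finset.card_map]
    exact (hS j).1
  · have hv := isRecoveringSet_iff.1 (hS j).2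
    refine isRecoveringSet_iff.2 fun x y hxy => hv x y fun b hb => ?_
    have := hxy (Fin.castLEEmb hmn b) (Finset.mem_map_of_mem _ hb)
    simpa using this

/-- The vector of the first seven binary digits of a number. -/
def digitVector (n : ℕ) : Fin 7 → ZMod 2 := fun i => if n.testBit i then 1 else 0

theorem digitVector_xor (a b : ℕ) :
    digitVector (a ^^^ b) = digitVector a + digitVector b := by
  funext i
  simp only [digitVector, Nat.testBit_xor, Pi.add_apply]
  cases a.testBit i <;> cases b.testBit i <;> decide

theorem exists_digitVector_eq (v : Fin 7 → ZMod 2) : ∃ n < 128, digitVector n = v := by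
  refine ⟨Nat.ofBits fun i => decide (v i = 1), Nat.ofBits_lt_two_pow _, ?_⟩
  funext i
  rw [digitVector, Nat.testBit_ofBits_lt _ _ i.2]
  have : ∀ z : ZMod 2, (if decide (z = 1) = true then (1 : ZMod 2) else 0) = z := by decide
  exact this (v i)

/-- The two linear forms stored in each of the seven buckets, as binary digits. -/
def cellForm : Fin 7 → Fin 2 → ℕ :=
  ![![4, 95], ![88, 2], ![37, 5], ![92, 54], ![17, 116], ![17, 67], ![72, 48]]

/-- The four combinations of the two linear forms of a bucket. -/
def bucketForm (b : Fin 7) : Fin 4 → ℕ :=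
  ![0, cellForm b 0, cellForm b 1, cellForm b 0 ^^^ cellForm b 1]

/-- A finite check that the pair spans of the seven lines cover all 128 requests; the zero form and
`b = c` are allowed, so single buckets are included. -/
theorem exists_bucketForm_xor_eq :
    ∀ n < 128, ∃ b c : Fin 7, ∃ p q : Fin 4, bucketForm b p ^^^ bucketForm c q = n := by
  decide +kernel

/-- The linear encoding map with the cells `cellForm`. -/
def sevenBucketEncoder : (Fin 7 → ZMod 2) →ₗ[ZMod 2] (Fin 7 → Fin 2 → ZMod 2) where
  toFun x b c := digitVector (cellForm b c) ⬝ᵥ x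
  map_add' x y := by
    funext b c
    exact dotProduct_add _ _ _
  map_smul' a x := by
    funext b c
    exact dotProduct_smul _ _ _

theorem digitVector_bucketForm_mem (b : Fin 7) (p : Fin 4) :
    digitVector (bucketForm b p) ∈ recoverable (⇑sevenBucketEncoder) {b} := by
  have hcell : ∀ c, digitVector (cellForm b c) ∈ recoverable (⇑sevenBucketEncoder) {b} :=
    fun c x y hxy => congrFun (hxy b (Finset.mem_singleton_self b)) c
  fin_cases p
  · have : digitVector 0 = 0 := by
      funext i
      simp [digitVector]
    exact this ▸ zero_mem _
  · exact hcell 0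
  · exact hcell 1
  · exact digitVector_xor (cellForm b 0) (cellForm b 1) ▸ add_mem (hcell 0) (hcell 1)

theorem isLocalityFunctionalArrayCode_sevenBucketEncoder :
    IsLocalityFunctionalArrayCode 7 1 7 2 2 sevenBucketEncoder := by
  intro v
  obtain ⟨n, hn, rfl⟩ := exists_digitVector_eq v
  obtain ⟨b, c, p, q, rfl⟩ := exists_bucketForm_xor_eq n hn
  refine ⟨fun _ => {b, c}, fun i j hij => absurd (Subsingleton.elim i j) hij, fun _ =>
    ⟨Finset.card_le_two, isRecoveringSet_iff.2 ?_⟩⟩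
  rw [digitVector_xor]
  exact add_mem (recoverable_mono (by simp) (digitVector_bucketForm_mem b p))
    (recoverable_mono (by simp) (digitVector_bucketForm_mem c q))

theorem theorem38 :
    localityD 7 1 2 2 = 7 ∧
      ∃ E : (Fin 7 → ZMod 2) →ₗ[ZMod 2] (Fin 7 → Fin 2 → ZMod 2),
        IsLocalityFunctionalArrayCode 7 1 7 2 2 E := by
  refine ⟨?_, sevenBucketEncoder, isLocalityFunctionalArrayCode_sevenBucketEncoder⟩
  have h7 : 7 ∈ {m : ℕ | ∃ E : ArrayEncoder 7 m 2, IsLocalityFunctionalArrayCode 7 1 m 2 2 E} :=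
    ⟨sevenBucketEncoder, isLocalityFunctionalArrayCode_sevenBucketEncoder⟩
  refine le_antisymm (Nat.sInf_le h7) (le_csInf ⟨7, h7⟩ ?_)
  rintro m ⟨E, hE⟩
  by_contra hm
  obtain ⟨E', hE'⟩ := exists_isLocalityFunctionalArrayCode_of_le (show m ≤ 6 by omega) hE
  exact not_isLocalityFunctionalArrayCode_six E' hE'
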